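/- Let $A$ be a finite alphabet. A \emph{class} is a set of languages over $A$; let $\mathcal{C}$ be a finite Boolean algebra of languages over $A$ (containing $\emptyset$ and $A^*$, closed under union, intersection and complement) which is \emph{quotienting}: for $L\in\mathcal{C}$ and $w\in A^*$, the languages $w^{-1}L=\{u\mid wu\in L\}$ and $Lw^{-1}=\{u\mid uw\in L\}$ belong to $\mathcal{C}$. Let $\mathrm{Pol}(\mathcal{C})$ be the least class containing $\mathcal{C}$ and closed under union and under marked concatenation $(K,L)\mapsto KaL$ for $a\in A$. Write $u\sim_{\mathcal{C}}v$ when $u$ and $v$ belong to the same languages of $\mathcal{C}$. For a class $\mathcal{D}$, a \emph{$\mathcal{D}$-cover} of a language $L$ is a finite set $\mathbf{K}\subseteq\mathcal{D}$ with $L\subseteq\bigcup_{K\in\mathbf{K}}K$. A \emph{multiplicative rating map} is a map $\rho:2^{A^*}\to R$ into a finite idempotent hemiring $R$ (a possibly non-unital semiring with $r+r=r$ for all $r$), such that $\rho(\emptyset)=0$, $\rho(K\cup L)=\rho(K)+\rho(L)$ and $\rho(KL)=\rho(K)\rho(L)$. $R$ is ordered by $r\le s\iff s+r=s$, and $\rho(w)$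 denotes $\rho(\{w\})$. The \emph{$\rho$-imprint} of $\mathbf{K}$ is $\{r\in R\mid r\le\rho(K)\text{ for some }K\in\mathbf{K}\}$. A $\mathcal{D}$-cover of $L$ is \emph{optimal} if its $\rho$-imprint is included in that of every $\mathcal{D}$-cover of $L$; the imprint shared by all optimal $\mathcal{D}$-covers of $L$ is denoted $\mathcal{I}_{\mathcal{D}}[L,\rho]$. For a morphism $\alpha:A^*\to M$ into a finite monoid, the \emph{$\mathcal{D}$-optimal $\alpha$-pointed $\rho$-imprint} is $$\mathcal{P}_{\mathcal{D}}[\alpha,\rho]=\{(s,r)\in M\times R\mid r\in\mathcal{I}_{\mathcal{D}}[\alpha^{-1}(s),\rho]\}.$$ Let $\alpha:A^*\to M$ be a morphism into a finite monoid that is \emph{$\mathcal{C}$-compatible}: for each $s\in M$ there is a $\sim_{\mathcal{C}}$-class containing $\alpha^{-1}(s)$; fix such a class $[s]_{\mathcal{C}}$ for every $s\in M$. Let $\rho:2^{A^*}\to R$ be an arbitrary multiplicative rating map. A set $S\subseteq M\times R$ is \emph{$\mathrm{Pol}(\mathcal{C})$-saturated} (for $\alpha$ and $\rho$) if \begin{itemize}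 \item $(\alpha(w),r)\in S$ for all $w\in A^*$ and $r\le\rho(w)$; \item (downset) if $(s,r)\in S$ and $r'\le r$, then $(s,r')\in S$; \item (multiplication) if $(s_1,r_1),(s_2,r_2)\in S$, then $(s_1s_2,r_1r_2)\in S$; \item ($\mathrm{Pol}(\mathcal{C})$-closure) if $(e,f)\in S$ with $ee=e$ and $ff=f$, then $(e,\,f\cdot\rho([e]_{\mathcal{C}})\cdot f)\in S$. \end{itemize} Then $\mathcal{P}_{\mathrm{Pol}(\mathcal{C})}[\alpha,\rho]$ is the least (for inclusion) $\mathrm{Pol}(\mathcal{C})$-saturated subset of $M\times R$. Moreover, for every finite quotienting Boolean algebra $\mathcal{C}$ over $A$, $\mathrm{Pol}(\mathcal{C})$-covering is decidable: there is an algorithm which, given nondeterministic finite automata for a regular language $L$ and for finitely many regular languages $L_1,\dots,L_n$ over $A$, decides whether $L$ has a $\mathrm{Pol}(\mathcal{C})$-cover $\mathbf{K}$ such that every $K\in\mathbf{K}$ is disjoint from some $L_i$. -/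

import Mathlib

namespace Covering

universe u v w

section Classes

variable {A : Type u}

/-- A class of languages is quotienting when it contains `w⁻¹L = {u | wu ∈ L}` and
`Lw⁻¹ = {u | uw ∈ L}` for all its members `L` and all words `w`. -/
structure IsQuotienting (C : Set (Language A)) : Prop where
  left_mem : ∀ L ∈ C, ∀ w : List A, ({u | w ++ u ∈ L} : Language A) ∈ C
  right_mem : ∀ L ∈ C, ∀ w : List A, ({u | u ++ w ∈ L} : Language A) ∈ C

/-- The polynomial closure of `C`: the least class containing `C` and closed under union
and marked concatenation `(K, L) ↦ KaL`. (On `Language A`, `+` is union and `*` is concatenation.) -/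
inductive Pol (C : Set (Language A)) : Set (Language A)
  | base (L : Language A) (hL : L ∈ C) : Pol C L
  | union (K L : Language A) (hK : Pol C K) (hL : Pol C L) : Pol C (K + L)
  | marked (K L : Language A) (a : A) (hK : Pol C K) (hL : Pol C L) :
      Pol C (K * ({[a]} : Language A) * L)

/-- The canonical equivalence of `C`: two words are equivalent when they belong to the same
languages of `C`. -/
def Sim (C : Set (Language A)) (w w' : List A) : Prop :=
  ∀ L ∈ C, w ∈ L ↔ w' ∈ L

/-- The equivalence class of the word `w` for the canonical equivalence of `C`. -/
def simClass (C : Set (Language A)) (w : List A) : Language A :=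
  {u | Sim C w u}

/-- `Ks` is a `D`-cover of `L`: a finite set of languages of `D` whose union contains `L`. -/
structure IsCover (D : Set (Language A)) (L : Language A) (Ks : Set (Language A)) : Prop where
  finite : Ks.Finite
  subset : Ks ⊆ D
  covers : ∀ w ∈ L, ∃ K ∈ Ks, w ∈ K

/-- The pair `(L, Ls)` is `D`-coverable: some `D`-cover `Ks` of `L` is separating for `Ls`, i.e.
each language in `Ks` is disjoint from some language in `Ls`. -/
def IsCoverable (D : Set (Language A)) (L : Language A) (Ls : Set (Language A)) : Prop :=
  ∃ Ks, IsCover D L Ks ∧ ∀ K ∈ Ks, ∃ L' ∈ Ls, Disjoint K L'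

end Classes

section Morphisms

variable {A : Type u} {M : Type v} [Monoid M]

/-- The language `α⁻¹(s)`. -/
def fiber (α : FreeMonoid A →* M) (s : M) : Language A :=
  {w | α (FreeMonoid.ofList w) = s}

/-- `cls` is a choice `s ↦ [s]_C` witnessing that `α` is `C`-compatible: every `cls s` is a
class of the canonical equivalence of `C` and contains `α⁻¹(s)`. -/
structure IsClassMap (C : Set (Language A)) (α : FreeMonoid A →* M) (cls : M → Language A) :
    Prop where
  isClass : ∀ s, ∃ w, cls s = simClass C w
  fiber_le : ∀ s, fiber α s ≤ cls s

end Morphisms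

section RatingMaps

variable {A : Type u} {M : Type v} [Monoid M] {R : Type w} [NonUnitalSemiring R]

/-- The canonical order `r ≤ s` of an idempotent hemiring. -/
def CanonLE (r s : R) : Prop :=
  s + r = s

/-- The `ρ`-imprint of a set of languages. -/
def imprint (ρ : Language A →ₙ+* R) (Ks : Set (Language A)) : Set R :=
  {r | ∃ K ∈ Ks, CanonLE r (ρ K)}

/-- `Ks` is an optimal `D`-cover of `L` for `ρ`. -/
def IsOptimalCover (D : Set (Language A)) (L : Language A) (ρ : Language A →ₙ+* R)
    (Ks : Set (Language A)) : Prop :=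
  IsCover D L Ks ∧ ∀ Ks', IsCover D L Ks' → imprint ρ Ks ⊆ imprint ρ Ks'

/-- The `D`-optimal `ρ`-imprint on `L`: the imprint shared by all optimal `D`-covers of `L`. -/
def optImprint (D : Set (Language A)) (L : Language A) (ρ : Language A →ₙ+* R) : Set R :=
  {r | ∃ Ks, IsOptimalCover D L ρ Ks ∧ r ∈ imprint ρ Ks}

/-- The `D`-optimal `α`-pointed `ρ`-imprint. -/
def pointedOptImprint (D : Set (Language A)) (α : FreeMonoid A →* M) (ρ : Language A →ₙ+* R) :
    Set (M × R) :=
  {p | p.2 ∈ optImprint D (fiber α p.1) ρ}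

/-- The trivial elements: the pairs `(α(w), r)` with `r ≤ ρ({w})`. -/
def trivialElements (α : FreeMonoid A →* M) (ρ : Language A →ₙ+* R) : Set (M × R) :=
  {p | ∃ w : List A, p.1 = α (FreeMonoid.ofList w) ∧ CanonLE p.2 (ρ ({w} : Language A))}

/-- `Pol(C)`-saturated subsets of `M × R` for `α` and `ρ`, where `cls` is the map `s ↦ [s]_C`. -/
structure IsPolSaturated (α : FreeMonoid A →* M) (cls : M → Language A)
    (ρ : Language A →ₙ+* R) (S : Set (M × R)) : Prop where
  trivial_subset : trivialElements α ρ ⊆ S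
  downset : ∀ s r r', (s, r) ∈ S → CanonLE r' r → (s, r') ∈ S
  mul_mem : ∀ s₁ r₁ s₂ r₂, (s₁, r₁) ∈ S → (s₂, r₂) ∈ S → (s₁ * s₂, r₁ * r₂) ∈ S
  pol_closure : ∀ e f, (e, f) ∈ S → IsIdempotentElem e → IsIdempotentElem f →
    (e, f * ρ (cls e) * f) ∈ S

end RatingMaps

section Decidability

variable {A : Type u}

/-- A finite nondeterministic automaton as finite data: the list of initial states, the list of
transitions `(q, a, q')`, and the list of accepting states. -/
abbrev NFACode (A : Type u) : Type u :=
  List ℕ × List (ℕ × A × ℕ) × List ℕ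

/-- The regular language recognized by the automaton coded by `c`. -/
def NFACode.language (c : NFACode A) : Language A :=
  NFA.accepts
    { step := fun q a => {q' | (q, a, q') ∈ c.2.1}
      start := {q | q ∈ c.1}
      accept := {q | q ∈ c.2.2} : NFA A ℕ }

/-- `D`-covering is decidable: there is an algorithm deciding, given automata for a regular
language `L` and for finitely many regular languages `L₁, …, Lₙ`, whether `(L, {L₁, …, Lₙ})` is
`D`-coverable. -/
def CoveringDecidable [Primcodable A] (D : Set (Language A)) : Prop :=
  ComputablePred fun p : NFACode A × List (NFACode A) =>
    IsCoverable D p.1.language {L | ∃ c ∈ p.2, L = NFACode.language c}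

end Decidability

end Covering

/-! Let `η : A* → N` be the quotient by the canonical equivalence of `C`, with `N` finite. A
monomial is a language `η⁻¹(x₀) a₁ η⁻¹(x₁) ⋯ aₙ η⁻¹(xₙ)` with `n` marks, and the polynomials are the
finite unions of monomials. Let `upLang η k w` consist of the words lying in every monomial with at
most `k` marks that contains `w`. For fixed `k` these languages are finitely many polynomials, and
as `k` grows they refine every polynomial cover. So `(s, r)` is in the optimal imprint iff for every
`k` some `w` over `s` satisfies `r ≤ ρ (upLang η k w)` (`mem_pointedOptImprint_iff`).

The imprint is saturated: a monomial with at most `k` marks leaves a copy of `w` unmarked in `w ^ (k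
+ 1)`, and when `η(w)` is idempotent this copy can absorb any word of the same value (`Mono.of_pow`,
`upLang_pow_mul_le`).

It is least: for a saturated `S`, every word `w` lies in a monomial with boundedly many marks whose
`ρ`-image is below some `r` with `(α(w), r) ∈ S`. This is an induction on two-sided ideals in a
finite monoid of elements of `S` (`IsValuation.exists_value`). As long as the product of a run of
values keeps its rank, only the two ends of the run need marks, and the middle is covered by one
class of the canonical equivalence; closure of `S` under the `Pol(C)` operation pays for this
(`isValuation_monoLang`). The number of marks depends only on the cardinalities of `M` and `R`.

This explicit bound gives decidability. With the rating map sending a language to its image in `M`,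
coverability becomes a statement about `MonoLE η k` for a computable `k` (`isCoverable_pol_iff`),
and a pumping argument restricts it to words of computable length. -/

namespace Covering

universe u v w x

/-! ### Monomials and the preorders they define -/

section Monomials

variable {A : Type u} {N : Type v} [Monoid N] (η : FreeMonoid A →* N)

/-- The value of a word under a morphism. -/
def wordVal (w : List A) : N := η (FreeMonoid.ofList w)

@[simp] lemma wordVal_nil : wordVal η [] = 1 := map_one η

@[simp] lemma wordVal_append (u v : List A) :
    wordVal η (u ++ v) = wordVal η u * wordVal η v := by
  simp [wordVal, FreeMonoid.ofList_append]

lemma wordVal_cons (a : A) (w : List A) : wordVal η (a :: w) = wordVal η [a] * wordVal η w := by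
  rw [← wordVal_append]; rfl

/-- `Mono η w x₀ [(a₁, x₁), …, (aₙ, xₙ)]`: the word `w` admits a factorization
`w₀ a₁ w₁ ⋯ aₙ wₙ` where each `wᵢ` has value `xᵢ`. -/
inductive Mono : List A → N → List (A × N) → Prop
  | nil : Mono [] 1 []
  | skip (a : A) (w : List A) (x : N) (l : List (A × N)) (h : Mono w x l) :
      Mono (a :: w) (wordVal η [a] * x) l
  | mark (a : A) (w : List A) (x : N) (l : List (A × N)) (h : Mono w x l) :
      Mono (a :: w) 1 ((a, x) :: l)

variable {η}

lemma mono_wordVal (w : List A) : Mono η w (wordVal η w) [] := by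
  induction w with
  | nil => simpa using Mono.nil
  | cons a w ih => rw [wordVal_cons]; exact .skip _ _ _ _ ih

lemma mono_nil_right_iff {w : List A} {x : N} : Mono η w x [] ↔ wordVal η w = x := by
  refine ⟨fun h => ?_, fun h => h ▸ mono_wordVal w⟩
  generalize hl : ([] : List (A × N)) = l at h
  induction h with
  | nil => simp
  | skip a w x l h ih => rw [wordVal_cons, ih hl]
  | mark => cases hl

lemma Mono.append_left {w : List A} {x : N} {l : List (A × N)} (h : Mono η w x l) (u : List A) :
    Mono η (u ++ w) (wordVal η u * x) l := by
  induction u with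
  | nil => simpa using h
  | cons a u ih =>
    rw [wordVal_cons, mul_assoc]; exact .skip _ _ _ _ ih

lemma mono_cons_right_iff {w : List A} {x y : N} {a : A} {l : List (A × N)} :
    Mono η w x ((a, y) :: l) ↔ ∃ u v, w = u ++ a :: v ∧ wordVal η u = x ∧ Mono η v y l := by
  constructor
  · intro h
    generalize hl : (a, y) :: l = l' at h
    induction h with
    | nil => cases hl
    | skip b w x l h ih =>
      obtain ⟨u, v, rfl, rfl, hv⟩ := ih hl
      exact ⟨b :: u, v, rfl, wordVal_cons _ _ _, hv⟩
    | mark b w x l h ih =>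
      cases hl
      exact ⟨[], w, rfl, by simp, h⟩
  · rintro ⟨u, v, rfl, rfl, hv⟩
    simpa using (Mono.mark a v y l hv).append_left u

lemma Mono.append_mark {u v : List A} {x y : N} {l l' : List (A × N)} {a : A}
    (hu : Mono η u x l) (hv : Mono η v y l') :
    Mono η (u ++ a :: v) x (l ++ (a, y) :: l') := by
  induction hu with
  | nil => exact .mark _ _ _ _ hv
  | skip b w x l h ih => exact .skip _ _ _ _ ih
  | mark b w x l h ih => exact .mark _ _ _ _ ih

lemma mono_append_mark_iff {w : List A} {x y : N} {l l' : List (A × N)} {a : A} :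
    Mono η w x (l ++ (a, y) :: l') ↔
      ∃ u v, w = u ++ a :: v ∧ Mono η u x l ∧ Mono η v y l' := by
  constructor
  · intro h
    induction l generalizing w x with
    | nil =>
      obtain ⟨u, v, rfl, rfl, hv⟩ := mono_cons_right_iff.1 h
      exact ⟨u, v, rfl, mono_wordVal u, hv⟩
    | cons p l ih =>
      obtain ⟨b, z⟩ := p
      obtain ⟨u, v, rfl, rfl, hv⟩ := mono_cons_right_iff.1 h
      obtain ⟨u', v', rfl, hu', hv'⟩ := ih hv
      exact ⟨u ++ b :: u', v', by simp, mono_cons_right_iff.2 ⟨u, u', rfl, rfl, hu'⟩, hv'⟩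
  · rintro ⟨u, v, rfl, hu, hv⟩
    exact hu.append_mark hv

/-- A monomial containing `u ++ v` is refined by a product of monomials containing `u` and `v`,
with the same total number of marks. -/
lemma Mono.split {u v : List A} {x : N} {l : List (A × N)} (h : Mono η (u ++ v) x l) :
    ∃ y l₁ z l₂, Mono η u y l₁ ∧ Mono η v z l₂ ∧ l₁.length + l₂.length = l.length ∧
      ∀ t u' v', Mono η u' (t * y) l₁ → Mono η v' z l₂ → Mono η (u' ++ v') (t * x) l := by
  induction u generalizing x l with
  | nil =>
    refine ⟨1, [], x, l, .nil, h, by simp, fun t u' v' hu' hv' => ?_⟩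
    rw [mul_one, mono_nil_right_iff] at hu'
    exact hu' ▸ hv'.append_left u'
  | cons a u ih =>
    cases h with
    -- The parameter `t` collects the values of skipped letters, so that the induction passes
    -- through an unmarked prefix.
    | skip _ _ x l h =>
      obtain ⟨y, l₁, z, l₂, hu, hv, hlen, H⟩ := ih h
      refine ⟨wordVal η [a] * y, l₁, z, l₂, .skip _ _ _ _ hu, hv, hlen, fun t u' v' hu' hv' => ?_⟩
      rw [← mul_assoc] at hu' ⊢
      exact H _ _ _ hu' hv'
    | mark _ _ x l h =>
      obtain ⟨y, l₁, z, l₂, hu, hv, hlen, H⟩ := ih h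
      refine ⟨1, (a, y) :: l₁, z, l₂, .mark _ _ _ _ hu, hv, by simp; omega,
        fun t u' v' hu' hv' => ?_⟩
      rw [mul_one] at hu' ⊢
      obtain ⟨p, q, rfl, rfl, hq⟩ := mono_cons_right_iff.1 hu'
      refine mono_cons_right_iff.2 ⟨p, q ++ v', by simp, rfl, ?_⟩
      simpa using H 1 q v' (by simpa using hq) hv'

/-- Two monomials containing a word have a common refinement containing it. -/
lemma Mono.merge {w : List A} {x x' : N} {l l' : List (A × N)} (h : Mono η w x l)
    (h' : Mono η w x' l') :
    ∃ y m, m.length ≤ l.length + l'.length ∧ Mono η w y m ∧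
      ∀ t u, Mono η u (t * y) m → Mono η u (t * x) l ∧ Mono η u (t * x') l' := by
  induction h generalizing x' l' with
  | nil =>
    cases h'
    exact ⟨1, [], by simp, .nil, fun t u hu => ⟨hu, hu⟩⟩
  | skip a w x l h ih =>
    cases h' with
    | skip _ _ x' l' h' =>
      obtain ⟨y, m, hm, hw, H⟩ := ih h'
      refine ⟨wordVal η [a] * y, m, hm, .skip _ _ _ _ hw, fun t u hu => ?_⟩
      simp only [← mul_assoc] at hu ⊢
      exact H _ _ hu
    | mark _ _ x' l' h' =>
      obtain ⟨y, m, hm, hw, H⟩ := ih h'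
      refine ⟨1, (a, y) :: m, by simp; omega, .mark _ _ _ _ hw, fun t u hu => ?_⟩
      rw [mul_one] at hu
      obtain ⟨p, q, rfl, rfl, hq⟩ := mono_cons_right_iff.1 hu
      have := H 1 q (by simpa using hq)
      rw [one_mul, one_mul] at this
      refine ⟨Mono.append_left (.skip _ _ _ _ this.1) p, ?_⟩
      rw [mul_one]
      exact mono_cons_right_iff.2 ⟨p, q, rfl, rfl, this.2⟩
  | mark a w x l h ih =>
    cases h' with
    | skip _ _ x' l' h' =>
      obtain ⟨y, m, hm, hw, H⟩ := ih h'
      refine ⟨1, (a, y) :: m, by simp; omega, .mark _ _ _ _ hw, fun t u hu => ?_⟩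
      rw [mul_one] at hu
      obtain ⟨p, q, rfl, rfl, hq⟩ := mono_cons_right_iff.1 hu
      have := H 1 q (by simpa using hq)
      rw [one_mul, one_mul] at this
      refine ⟨?_, Mono.append_left (.skip _ _ _ _ this.2) p⟩
      rw [mul_one]
      exact mono_cons_right_iff.2 ⟨p, q, rfl, rfl, this.1⟩
    | mark _ _ x' l' h' =>
      obtain ⟨y, m, hm, hw, H⟩ := ih h'
      refine ⟨1, (a, y) :: m, by simp; omega, .mark _ _ _ _ hw, fun t u hu => ?_⟩
      rw [mul_one] at hu
      obtain ⟨p, q, rfl, rfl, hq⟩ := mono_cons_right_iff.1 hu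
      have := H 1 q (by simpa using hq)
      rw [one_mul, one_mul] at this
      rw [mul_one]
      exact ⟨mono_cons_right_iff.2 ⟨p, q, rfl, rfl, this.1⟩,
        mono_cons_right_iff.2 ⟨p, q, rfl, rfl, this.2⟩⟩

variable (η)

/-- The language of the words belonging to a monomial. -/
def monoLang (x : N) (l : List (A × N)) : Language A := {w | Mono η w x l}

variable {η}

@[simp] lemma mem_monoLang {x : N} {l : List (A × N)} {w : List A} :
    w ∈ monoLang η x l ↔ Mono η w x l := Iff.rfl

lemma monoLang_append_mark (x y : N) (l l' : List (A × N)) (a : A) :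
    monoLang η x (l ++ (a, y) :: l') =
      monoLang η x l * ({[a]} : Language A) * monoLang η y l' := by
  ext w
  simp only [mem_monoLang, mono_append_mark_iff, Language.mem_mul]
  constructor
  · rintro ⟨u, v, rfl, hu, hv⟩
    exact ⟨u ++ [a], ⟨u, hu, [a], rfl, rfl⟩, v, hv, by simp⟩
  · rintro ⟨_, ⟨u, hu, b, hb, rfl⟩, v, hv, rfl⟩
    obtain rfl : b = [a] := hb
    exact ⟨u, v, by simp, hu, hv⟩

/-- The concatenation of two monomials is a neighbourhood of each of its words: one extra mark
suffices. -/
lemma Mono.exists_append {u v : List A} {x y : N} {l l' : List (A × N)} (hu : Mono η u x l)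
    (hv : Mono η v y l') :
    ∃ m, m.length ≤ l.length + l'.length + 1 ∧ Mono η (u ++ v) x m ∧
      monoLang η x m ≤ monoLang η x l * monoLang η y l' := by
  cases hv with
  | nil =>
    refine ⟨l, by omega, by simpa using hu, fun w hw => ?_⟩
    exact Language.mem_mul.2 ⟨w, hw, [], .nil, by simp⟩
  | skip a v y l' h =>
    refine ⟨l ++ (a, y) :: l', by simp; omega, hu.append_mark h, fun w hw => ?_⟩
    obtain ⟨p, q, rfl, hp, hq⟩ := mono_append_mark_iff.1 hw
    exact Language.mem_mul.2 ⟨p, hp, a :: q, .skip _ _ _ _ hq, rfl⟩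
  | mark a v y l' h =>
    refine ⟨l ++ (a, y) :: l', by simp, hu.append_mark h, fun w hw => ?_⟩
    obtain ⟨p, q, rfl, hp, hq⟩ := mono_append_mark_iff.1 hw
    exact Language.mem_mul.2 ⟨p, hp, a :: q, .mark _ _ _ _ hq, rfl⟩

variable (η)

/-- Every monomial with at most `k` marks containing `w` contains `v`. -/
def MonoLE (k : ℕ) (w v : List A) : Prop :=
  ∀ x l, l.length ≤ k → Mono η w x l → Mono η v x l

/-- The language of the words above `w` for `MonoLE η k`. -/
def upLang (k : ℕ) (w : List A) : Language A := {v | MonoLE η k w v}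

variable {η}

lemma MonoLE.refl (k : ℕ) (w : List A) : MonoLE η k w w := fun _ _ _ h => h

lemma MonoLE.mono {j k : ℕ} (hjk : j ≤ k) {w v : List A} (h : MonoLE η k w v) : MonoLE η j w v :=
  fun x l hl => h x l (hl.trans hjk)

lemma MonoLE.wordVal_eq {k : ℕ} {w v : List A} (h : MonoLE η k w v) :
    wordVal η v = wordVal η w :=
  mono_nil_right_iff.1 (h _ [] (by simp) (mono_wordVal w))

/-- Cutting a monomial between the two factors distributes its marks, so neither half has more than
`k` of them. -/
lemma MonoLE.append {k : ℕ} {w w' v v' : List A} (h : MonoLE η k w v) (h' : MonoLE η k w' v') :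
    MonoLE η k (w ++ w') (v ++ v') := by
  intro x l hl hw
  obtain ⟨y, l₁, z, l₂, h₁, h₂, hlen, H⟩ := hw.split
  simpa using H 1 v v' (by simpa using h _ _ (by omega) h₁) (h' _ _ (by omega) h₂)

lemma MonoLE.flatten_replicate {k : ℕ} {w : List A} {us : List (List A)}
    (h : ∀ u ∈ us, MonoLE η k w u) :
    MonoLE η k (List.replicate us.length w).flatten us.flatten := by
  induction us with
  | nil => exact MonoLE.refl _ _
  | cons u us ih =>
    rw [List.length_cons, List.replicate_succ, List.flatten_cons, List.flatten_cons]
    exact (h u (by simp)).append (ih fun v hv => h v (by simp [hv]))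

lemma wordVal_flatten_append {x : N} (hx : IsIdempotentElem x) {us : List (List A)}
    (h : ∀ u ∈ us, wordVal η u = x) {z : List A} (hz : wordVal η z = x) :
    wordVal η (us.flatten ++ z) = x := by
  induction us with
  | nil => simpa using hz
  | cons u us ih =>
    rw [List.flatten_cons, List.append_assoc, wordVal_append, h u (by simp),
      ih fun v hv => h v (by simp [hv]), hx]

lemma wordVal_append_flatten {x : N} (hx : IsIdempotentElem x) {us : List (List A)}
    (h : ∀ u ∈ us, wordVal η u = x) {z : List A} (hz : wordVal η z = x) :
    wordVal η (z ++ us.flatten) = x := by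
  induction us generalizing z with
  | nil => simpa using hz
  | cons u us ih =>
    rw [List.flatten_cons, ← List.append_assoc]
    exact ih (fun v hv => h v (by simp [hv])) (by rw [wordVal_append, h u (by simp), hz, hx])

/-- A monomial with at most `j` marks leaves some copy of `w` unmarked in `w ^ (j + 1)`; if the value
of `w` is idempotent, this copy absorbs a word of the same value. -/
lemma Mono.of_pow {j k : ℕ} {w z : List A} (hw : IsIdempotentElem (wordVal η w))
    (hz : wordVal η z = wordVal η w) {us vs : List (List A)} (hus : j ≤ us.length)
    (hvs : j ≤ vs.length) (hu : ∀ u ∈ us, MonoLE η k w u) (hv : ∀ u ∈ vs, MonoLE η k w u)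
    {x : N} {l : List (A × N)} (hl : l.length ≤ j) (hjk : j ≤ k)
    (h : Mono η (List.replicate (j + 1) w).flatten x l) :
    Mono η (us.flatten ++ (z ++ vs.flatten)) x l := by
  have hval : ∀ us' vs' : List (List A), us' ⊆ us → vs' ⊆ vs →
      wordVal η (us'.flatten ++ (z ++ vs'.flatten)) = wordVal η w := fun us' vs' h₁ h₂ =>
    wordVal_flatten_append hw (fun u hu' => (hu u (h₁ hu')).wordVal_eq)
      (wordVal_append_flatten hw (fun u hu' => (hv u (h₂ hu')).wordVal_eq) hz)
  induction j generalizing x l us with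
  | zero =>
    obtain rfl : l = [] := List.length_eq_zero_iff.1 (by omega)
    rw [mono_nil_right_iff] at h ⊢
    rw [hval us vs (by simp) (by simp), ← h]
    simp
  | succ j ih =>
    rw [List.replicate_succ, List.flatten_cons] at h
    obtain ⟨y, l₁, z', l₂, h₁, h₂, hlen, H⟩ := h.split
    cases l₁ with
    -- The first copy of `w` carries no mark: it absorbs `us`, `z` and all but the last `j + 1`
    -- words of `vs`, which match the remaining `j + 1` copies one by one.
    | nil =>
      rw [mono_nil_right_iff] at h₁
      have hcut : us.flatten ++ (z ++ vs.flatten) =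
          (us.flatten ++ (z ++ (vs.take (vs.length - (j + 1))).flatten)) ++
            (vs.drop (vs.length - (j + 1))).flatten := by
        simp only [List.append_assoc, ← List.flatten_append, List.take_append_drop]
      have hdrop := MonoLE.flatten_replicate (us := vs.drop (vs.length - (j + 1)))
        fun u hu => hv u (List.mem_of_mem_drop hu)
      rw [List.length_drop, Nat.sub_sub_self hvs] at hdrop
      rw [hcut, ← one_mul x]
      refine H 1 _ _ ?_ (hdrop _ _ (by simp at hlen; omega) h₂)
      rw [mono_nil_right_iff, hval us _ (by simp) (List.take_subset _ _), h₁, one_mul]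
    -- The first copy carries a mark: it is matched with the first word of `us`, leaving one copy
    -- fewer and at least one mark fewer.
    | cons b l₁ =>
      cases us with
      | nil => simp at hus
      | cons u us =>
        have := ih (us := us) (by simpa using hus) (by omega) (fun u' hu' => hu u' (by simp [hu']))
          (l := l₂) (by simp at hlen; omega) (by omega) h₂
          (fun us' vs' h₁ h₂ => hval us' vs' (fun _ hx => by simp [h₁ hx]) h₂)
        rw [List.flatten_cons, List.append_assoc, ← one_mul x]
        refine H 1 _ _ ?_ this
        rw [one_mul]
        exact hu u (by simp) _ _ (by omega) h₁

end Monomials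

lemma finite_monomials {A : Type u} {N : Type v} [Finite A] [Finite N] (k : ℕ) :
    {m : N × List (A × N) | m.2.length ≤ k}.Finite := by
  have : {m : N × List (A × N) | m.2.length ≤ k} = Set.univ ×ˢ {l | l.length ≤ k} := by
    ext; simp
  rw [this]
  exact Set.finite_univ.prod (List.finite_length_le _ _)

/-! ### Polynomials as finite unions of monomials, and cofinal covers -/

section Polynomials

variable {A : Type u} {N : Type v} [Monoid N]

/-- A surjective morphism whose kernel is the canonical equivalence of `C`. -/
structure IsClassMorphism (C : Set (Language A)) (η : FreeMonoid A →* N) : Prop where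
  surjective : ∀ x, ∃ w, wordVal η w = x
  wordVal_eq_iff : ∀ u v, wordVal η u = wordVal η v ↔ Sim C u v

lemma Sim.append {C : Set (Language A)} (hC : IsQuotienting C) {u u' v v' : List A}
    (hu : Sim C u u') (hv : Sim C v v') : Sim C (u ++ v) (u' ++ v') := by
  intro L hL
  exact (hv _ (hC.left_mem L hL u)).trans (hu _ (hC.right_mem L hL v'))

/-- The canonical equivalence of a quotienting class is a congruence. -/
def simCon (C : Set (Language A)) (hC : IsQuotienting C) : Con (FreeMonoid A) where
  r u v := Sim C u.toList v.toList
  iseqv := ⟨fun _ _ _ => Iff.rfl, fun h L hL => (h L hL).symm,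
    fun h h' L hL => (h L hL).trans (h' L hL)⟩
  mul' h h' := h.append hC h'

lemma isClassMorphism_simCon (C : Set (Language A)) (hC : IsQuotienting C) :
    IsClassMorphism C (simCon C hC).mk' where
  surjective x := (simCon C hC).mk'_surjective x
  wordVal_eq_iff _ _ := Con.eq _

lemma finite_simCon_quotient (C : Set (Language A)) (hC : IsQuotienting C) (hfin : C.Finite) :
    Finite (simCon C hC).Quotient := by
  have : Finite C := hfin
  refine Finite.of_injective (β := Set C)
    (fun x => {L | Quotient.out x ∈ (L : Language A)}) fun x y hxy => ?_
  rw [← Quotient.out_eq x, ← Quotient.out_eq y]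
  refine (Con.eq (simCon C hC)).2 fun L hL => ?_
  exact Set.ext_iff.1 hxy ⟨L, hL⟩

/-- A class is the finite intersection of the members of `C` containing `w` and the complements of
the others. -/
lemma simClass_mem (C : BooleanSubalgebra (Language A)) (hfin : (C : Set (Language A)).Finite)
    (w : List A) : simClass (C : Set (Language A)) w ∈ C := by
  suffices ∀ F : Set (Language A), F.Finite → F ⊆ C →
      ({v | ∀ L ∈ F, w ∈ L ↔ v ∈ L} : Language A) ∈ C from this _ hfin subset_rfl
  intro F hF
  induction F, hF using Set.Finite.induction_on with
  | empty =>
    intro _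
    have : ({v | ∀ L ∈ (∅ : Set (Language A)), w ∈ L ↔ v ∈ L} : Language A) = ⊤ := by
      ext v
      exact ⟨fun _ => trivial, fun _ L hL => hL.elim⟩
    rw [this]
    exact C.top_mem
  | @insert L F _ _ ih =>
    intro hFC
    have hL : L ∈ C := hFC (by simp)
    have ih := ih fun _ h => hFC (by simp [h])
    by_cases hw : w ∈ L
    · have : ({v | ∀ K ∈ insert L F, w ∈ K ↔ v ∈ K} : Language A) =
          L ⊓ ({v | ∀ K ∈ F, w ∈ K ↔ v ∈ K} : Language A) := by
        ext v
        refine Set.forall_mem_insert.trans (and_congr ?_ Iff.rfl)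
        simp only [hw, true_iff]
        rfl
      rw [this]
      exact C.inf_mem hL ih
    · have : ({v | ∀ K ∈ insert L F, w ∈ K ↔ v ∈ K} : Language A) =
          Lᶜ ⊓ ({v | ∀ K ∈ F, w ∈ K ↔ v ∈ K} : Language A) := by
        ext v
        refine Set.forall_mem_insert.trans (and_congr ?_ Iff.rfl)
        simp only [hw, false_iff]
        rfl
      rw [this]
      exact C.inf_mem (C.compl_mem hL) ih

lemma IsClassMorphism.monoLang_nil {C : Set (Language A)} {η : FreeMonoid A →* N}
    (hη : IsClassMorphism C η) (w : List A) :
    monoLang η (wordVal η w) [] = simClass C w := by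
  ext v
  rw [mem_monoLang, mono_nil_right_iff, eq_comm, hη.wordVal_eq_iff]
  rfl

variable {C : BooleanSubalgebra (Language A)} {η : FreeMonoid A →* N}

lemma monoLang_mem_pol (hη : IsClassMorphism (C : Set (Language A)) η)
    (hfin : (C : Set (Language A)).Finite) (x : N) (l : List (A × N)) :
    monoLang η x l ∈ Pol (C : Set (Language A)) := by
  have hnil : ∀ x, monoLang η x [] ∈ Pol (C : Set (Language A)) := fun x => by
    obtain ⟨w, rfl⟩ := hη.surjective x
    rw [hη.monoLang_nil]
    exact .base _ (simClass_mem C hfin w)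
  induction l generalizing x with
  | nil => exact hnil x
  | cons p l ih =>
    have := monoLang_append_mark (η := η) x p.2 [] l p.1
    rw [List.nil_append] at this
    rw [this]
    exact .marked _ _ _ (hnil x) (ih p.2)

lemma sSup_mem_pol {F : Set (Language A)} (hF : F.Finite)
    (h : F ⊆ Pol (C : Set (Language A))) : sSup F ∈ Pol (C : Set (Language A)) := by
  induction F, hF using Set.Finite.induction_on with
  | empty => rw [sSup_empty]; exact .base _ C.bot_mem
  | @insert L F _ _ ih =>
    rw [sSup_insert]
    exact .union _ _ (h (Set.mem_insert L F)) (ih fun _ h' => h (by simp [h']))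

/-- A language all of whose words have a monomial neighbourhood with a bounded number of marks is a
polynomial. -/
lemma mem_pol_of_forall_mono [Finite A] [Finite N] (hη : IsClassMorphism (C : Set (Language A)) η)
    (hfin : (C : Set (Language A)).Finite) {L : Language A} {k : ℕ}
    (h : ∀ w ∈ L, ∃ x l, l.length ≤ k ∧ Mono η w x l ∧ monoLang η x l ≤ L) :
    L ∈ Pol (C : Set (Language A)) := by
  set F := (fun m : N × List (A × N) => monoLang η m.1 m.2) ''
    {m | m.2.length ≤ k ∧ monoLang η m.1 m.2 ≤ L} with hF
  have hfinF : F.Finite := ((finite_monomials k).subset fun m hm => hm.1).image _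
  have hL : L = sSup F := by
    ext w
    constructor
    · intro hw
      obtain ⟨x, l, hl, hwl, hle⟩ := h w hw
      exact ⟨_, ⟨(x, l), ⟨hl, hle⟩, rfl⟩, hwl⟩
    · rintro ⟨_, ⟨m, ⟨-, hle⟩, rfl⟩, hw⟩
      exact hle hw
  rw [hL]
  refine sSup_mem_pol hfinF ?_
  · rintro _ ⟨m, -, rfl⟩
    exact monoLang_mem_pol hη hfin _ _

/-- Every word of a polynomial has a monomial neighbourhood with a bounded number of marks. -/
lemma exists_mono_of_mem_pol (hη : IsClassMorphism (C : Set (Language A)) η) {L : Language A}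
    (hL : L ∈ Pol (C : Set (Language A))) :
    ∃ k, ∀ w ∈ L, ∃ x l, l.length ≤ k ∧ Mono η w x l ∧ monoLang η x l ≤ L := by
  induction hL with
  | base L hL =>
    refine ⟨0, fun w hw => ⟨wordVal η w, [], le_rfl, mono_wordVal w, ?_⟩⟩
    rw [hη.monoLang_nil]
    exact fun v hv => (hv L hL).1 hw
  | union K L _ _ ihK ihL =>
    obtain ⟨j, hj⟩ := ihK
    obtain ⟨k, hk⟩ := ihL
    refine ⟨max j k, fun w hw => ?_⟩
    rcases hw with hw | hw
    · obtain ⟨x, l, hl, hwl, hle⟩ := hj w hw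
      exact ⟨x, l, hl.trans (le_max_left _ _), hwl, hle.trans fun v hv => Or.inl hv⟩
    · obtain ⟨x, l, hl, hwl, hle⟩ := hk w hw
      exact ⟨x, l, hl.trans (le_max_right _ _), hwl, hle.trans fun v hv => Or.inr hv⟩
  | marked K L a _ _ ihK ihL =>
    obtain ⟨j, hj⟩ := ihK
    obtain ⟨k, hk⟩ := ihL
    refine ⟨j + k + 1, fun w hw => ?_⟩
    obtain ⟨_, ⟨u, hu, b, hb, rfl⟩, v, hv, rfl⟩ := hw
    obtain rfl : b = [a] := hb
    obtain ⟨x, l, hl, hul, hle⟩ := hj u hu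
    obtain ⟨y, l', hl', hvl, hle'⟩ := hk v hv
    refine ⟨x, l ++ (a, y) :: l', by simp; omega, by simpa using hul.append_mark hvl, ?_⟩
    rw [monoLang_append_mark]
    exact mul_le_mul' (mul_le_mul' hle le_rfl) hle'

lemma exists_upLang_le_of_mem_pol (hη : IsClassMorphism (C : Set (Language A)) η) {L : Language A}
    (hL : L ∈ Pol (C : Set (Language A))) : ∃ k, ∀ w ∈ L, upLang η k w ≤ L := by
  obtain ⟨k, hk⟩ := exists_mono_of_mem_pol hη hL
  refine ⟨k, fun w hw v hv => ?_⟩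
  obtain ⟨x, l, hl, hwl, hle⟩ := hk w hw
  exact hle (hv x l hl hwl)

/-- Finitely many monomials containing a word have a common refinement containing it. -/
lemma exists_mono_refining {F : Set (N × List (A × N))} (hF : F.Finite) :
    ∃ k, ∀ w, (∀ m ∈ F, Mono η w m.1 m.2) → ∃ x l, l.length ≤ k ∧ Mono η w x l ∧
      ∀ m ∈ F, monoLang η x l ≤ monoLang η m.1 m.2 := by
  induction F, hF using Set.Finite.induction_on with
  | empty => exact ⟨0, fun w _ => ⟨_, [], le_rfl, mono_wordVal w, by simp⟩⟩
  | @insert m F _ _ ih =>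
    obtain ⟨k, hk⟩ := ih
    refine ⟨m.2.length + k, fun w hw => ?_⟩
    obtain ⟨x, l, hl, hwl, hle⟩ := hk w fun m' hm' => hw m' (by simp [hm'])
    obtain ⟨y, l', hl', hwl', H⟩ := (hw m (by simp)).merge hwl
    have H' : ∀ u, Mono η u y l' → Mono η u m.1 m.2 ∧ Mono η u x l := fun u hu => by
      simpa using H 1 u (by simpa using hu)
    refine ⟨y, l', by omega, hwl', ?_⟩
    rintro m' (rfl | hm') u hu
    · exact (H' u hu).1
    · exact hle m' hm' (H' u hu).2

/-- This language is an intersection of finitely many monomials. A common refinement around each of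
its words, with uniformly bounded marks, makes it a finite union of monomials. -/
lemma upLang_mem_pol [Finite A] [Finite N] (hη : IsClassMorphism (C : Set (Language A)) η)
    (hfin : (C : Set (Language A)).Finite) (k : ℕ) (w : List A) :
    upLang η k w ∈ Pol (C : Set (Language A)) := by
  obtain ⟨j, hj⟩ := exists_mono_refining (η := η)
    ((finite_monomials k).subset (t := {m : N × List (A × N) | m.2.length ≤ k ∧ Mono η w m.1 m.2})
      fun m hm => hm.1)
  refine mem_pol_of_forall_mono hη hfin (k := j) fun v hv => ?_
  obtain ⟨x, l, hl, hvl, hle⟩ := hj v fun m hm => hv _ _ hm.1 hm.2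
  exact ⟨x, l, hl, hvl, fun u hu y l' hl' hwl' => hle (y, l') ⟨hl', hwl'⟩ hu⟩

/-- The language depends only on which of the finitely many monomials with at most `k` marks contain
`w`. -/
lemma finite_range_upLang [Finite A] [Finite N] (k : ℕ) :
    (Set.range (upLang (η := η) k)).Finite := by
  have : Finite {m : N × List (A × N) | m.2.length ≤ k} := finite_monomials k
  refine (Set.finite_range fun F : Set {m : N × List (A × N) | m.2.length ≤ k} =>
    ({v | ∀ m ∈ F, Mono η v m.1.1 m.1.2} : Language A)).subset ?_
  rintro _ ⟨w, rfl⟩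
  refine ⟨{m | Mono η w m.1.1 m.1.2}, ?_⟩
  ext v
  exact ⟨fun h x l hl hw => h ⟨(x, l), hl⟩ hw, fun h m hm => h _ _ m.2 hm⟩

lemma isCover_upLang [Finite A] [Finite N] (hη : IsClassMorphism (C : Set (Language A)) η)
    (hfin : (C : Set (Language A)).Finite) (k : ℕ) (L : Language A) :
    IsCover (Pol (C : Set (Language A))) L (upLang η k '' {w | w ∈ L}) where
  finite := (finite_range_upLang k).subset (Set.image_subset_range _ _)
  subset := by rintro _ ⟨w, -, rfl⟩; exact upLang_mem_pol hη hfin k w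
  covers w hw := ⟨_, ⟨w, hw, rfl⟩, MonoLE.refl k w⟩

/-- The covers by the languages `upLang η k w` refine all polynomial covers. -/
lemma IsCover.exists_upLang_le (hη : IsClassMorphism (C : Set (Language A)) η) {L : Language A}
    {Ks : Set (Language A)} (h : IsCover (Pol (C : Set (Language A))) L Ks) :
    ∃ k, ∀ w ∈ L, ∃ K ∈ Ks, upLang η k w ≤ K := by
  obtain ⟨k, hk⟩ : ∃ k, ∀ K ∈ Ks, ∀ w ∈ K, upLang η k w ≤ K := by
    have hsub := h.subset
    obtain ⟨hKs, -, -⟩ := h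
    induction Ks, hKs using Set.Finite.induction_on with
    | empty => exact ⟨0, by simp⟩
    | @insert K Ks _ _ ih =>
      obtain ⟨j, hj⟩ := exists_upLang_le_of_mem_pol hη (hsub (Set.mem_insert K Ks))
      obtain ⟨k, hk⟩ := ih fun _ h => hsub (by simp [h])
      refine ⟨max j k, ?_⟩
      rintro K' (rfl | hK') w hw v hv
      · exact hj w hw (MonoLE.mono (le_max_left _ _) hv)
      · exact hk K' hK' w hw (MonoLE.mono (le_max_right _ _) hv)
  refine ⟨k, fun w hw => ?_⟩
  obtain ⟨K, hK, hwK⟩ := h.covers w hw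
  exact ⟨K, hK, hk K hK w hwK⟩

end Polynomials

/-! ### The canonical order of an idempotent hemiring -/

section CanonicalOrder

variable {A : Type u} {R : Type w} [NonUnitalSemiring R]

lemma CanonLE.trans {r s t : R} (h : CanonLE r s) (h' : CanonLE s t) : CanonLE r t := by
  unfold CanonLE at *
  rw [← h', add_assoc, h]

lemma CanonLE.mul (hR : ∀ r : R, r + r = r) {r r' s s' : R} (h : CanonLE r r')
    (h' : CanonLE s s') : CanonLE (r * s) (r' * s') := by
  unfold CanonLE at *
  rw [← h, ← h', add_mul, mul_add, mul_add]
  simp only [add_assoc, hR]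

lemma canonLE_map (ρ : Language A →ₙ+* R) {K L : Language A} (h : K ≤ L) :
    CanonLE (ρ K) (ρ L) := by
  unfold CanonLE
  rw [← map_add, add_comm, (Language.le_iff K L).1 h]

end CanonicalOrder

/-! ### The optimal imprint is saturated -/

section Soundness

variable {A : Type u} {N : Type v} [Monoid N]
  {C : BooleanSubalgebra (Language A)} {η : FreeMonoid A →* N}
  {M : Type w} [Monoid M] {α : FreeMonoid A →* M}
  {R : Type x} [NonUnitalSemiring R] {ρ : Language A →ₙ+* R}

lemma IsClassMap.eq_monoLang {C : Set (Language A)} {cls : M → Language A}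
    (hcls : IsClassMap C α cls) (hη : IsClassMorphism C η) (w : List A) :
    cls (wordVal α w) = monoLang η (wordVal η w) [] := by
  obtain ⟨v, hv⟩ := hcls.isClass (wordVal α w)
  have hw : w ∈ cls (wordVal α w) := hcls.fiber_le _ rfl
  rw [hv, ← hη.monoLang_nil, mem_monoLang, mono_nil_right_iff] at hw
  rw [hv, ← hη.monoLang_nil, hw]

/-- The covers by languages `upLang η k w` refine all others for large `k`, so their imprints,
decreasing in `k`, stabilize at the optimal one. -/
lemma mem_pointedOptImprint_iff [Finite A] [Finite N] [Finite R]
    (hη : IsClassMorphism (C : Set (Language A)) η) (hfin : (C : Set (Language A)).Finite)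
    {s : M} {r : R} :
    (s, r) ∈ pointedOptImprint (Pol (C : Set (Language A))) α ρ ↔
      ∀ k, ∃ w, wordVal α w = s ∧ CanonLE r (ρ (upLang η k w)) := by
  constructor
  · rintro ⟨Ks, ⟨-, hopt⟩, hr⟩ k
    obtain ⟨_, ⟨w, hw, rfl⟩, h⟩ := hopt _ (isCover_upLang hη hfin k (fiber α s)) hr
    exact ⟨w, hw, h⟩
  · intro h
    let I : ℕ → Set R := fun k => imprint ρ (upLang η k '' {w | w ∈ fiber α s})
    have hI : ∀ j k, j ≤ k → I k ⊆ I j := by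
      rintro j k hjk r ⟨_, ⟨w, hw, rfl⟩, hr⟩
      exact ⟨_, ⟨w, hw, rfl⟩, hr.trans (canonLE_map ρ fun v hv => MonoLE.mono hjk hv)⟩
    -- In a decreasing sequence of finite sets, a term of least cardinality is contained in all the
    -- others.
    obtain ⟨k₀, hk₀⟩ : ∃ k₀, ∀ k, I k₀ ⊆ I k := by
      obtain ⟨k₀, hmin⟩ : ∃ k₀, ∀ k, (I k₀).ncard ≤ (I k).ncard :=
        ⟨_, fun k => Function.argmin_le (fun k => (I k).ncard) k⟩
      refine ⟨k₀, fun k => ?_⟩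
      rcases le_total k k₀ with hk | hk
      · exact hI _ _ hk
      · exact (Set.eq_of_subset_of_ncard_le (hI _ _ hk) (hmin k)).ge
    have hcov := isCover_upLang hη hfin k₀ (fiber α s)
    refine ⟨_, ⟨hcov, fun Ks' hKs' => ?_⟩, ?_⟩
    · obtain ⟨k, hk⟩ := hKs'.exists_upLang_le hη
      refine (hk₀ k).trans ?_
      rintro r ⟨_, ⟨w, hw, rfl⟩, hr⟩
      obtain ⟨K, hK, hle⟩ := hk w hw
      exact ⟨K, hK, hr.trans (canonLE_map ρ hle)⟩
    · obtain ⟨w, hw, hr⟩ := h k₀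
      exact ⟨_, ⟨w, hw, rfl⟩, hr⟩

lemma upLang_mul_le (k : ℕ) (u v : List A) :
    upLang η k u * upLang η k v ≤ upLang η k (u ++ v) := by
  rintro _ ⟨p, hp, q, hq, rfl⟩
  exact MonoLE.append hp hq

lemma upLang_pow_mul_le (k : ℕ) {w : List A} (hw : IsIdempotentElem (wordVal η w)) :
    upLang η k w ^ (k + 1) * monoLang η (wordVal η w) [] * upLang η k w ^ (k + 1) ≤
      upLang η k (List.replicate (k + 1) w).flatten := by
  rintro _ ⟨_, ⟨p, hp, z, hz, rfl⟩, q, hq, rfl⟩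
  obtain ⟨us, rfl, hus, hu⟩ := Language.mem_pow.1 hp
  obtain ⟨vs, rfl, hvs, hv⟩ := Language.mem_pow.1 hq
  intro x l hl h
  have := Mono.of_pow (j := k) (k := k) hw (mono_nil_right_iff.1 hz) (us := us) (vs := vs)
    (by omega) (by omega) hu hv hl le_rfl h
  simpa using this

lemma wordVal_flatten_replicate {e : M} (he : IsIdempotentElem e) {w : List A}
    (hw : wordVal α w = e) (k : ℕ) : wordVal α (List.replicate (k + 1) w).flatten = e := by
  rw [List.replicate_succ', List.flatten_append]
  exact wordVal_flatten_append he (fun u hu => List.eq_of_mem_replicate hu ▸ hw) (by simpa using hw)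

lemma canonLE_map_pow (hR : ∀ r : R, r + r = r) {f : R} (hf : IsIdempotentElem f)
    {K : Language A} (h : CanonLE f (ρ K)) (k : ℕ) : CanonLE f (ρ (K ^ (k + 1))) := by
  induction k with
  | zero => simpa using h
  | succ k ih =>
    rw [pow_succ, map_mul, ← hf.eq]
    exact ih.mul hR h

theorem isPolSaturated_pointedOptImprint [Finite A] [Finite N] [Finite R]
    (hη : IsClassMorphism (C : Set (Language A)) η) (hfin : (C : Set (Language A)).Finite)
    {cls : M → Language A}
    (hcls : IsClassMap (C : Set (Language A)) α cls) (hR : ∀ r : R, r + r = r) :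
    IsPolSaturated α cls ρ (pointedOptImprint (Pol (C : Set (Language A))) α ρ) where
  trivial_subset := by
    rintro ⟨s, r⟩ ⟨w, rfl, hr⟩
    refine (mem_pointedOptImprint_iff hη hfin).2 fun k => ⟨w, rfl, hr.trans (canonLE_map ρ ?_)⟩
    rintro v hv
    obtain rfl : v = w := hv
    exact MonoLE.refl _ _
  downset s r r' h hr := by
    rw [mem_pointedOptImprint_iff hη hfin] at h ⊢
    intro k
    obtain ⟨w, hw, h⟩ := h k
    exact ⟨w, hw, hr.trans h⟩
  mul_mem s₁ r₁ s₂ r₂ h₁ h₂ := by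
    rw [mem_pointedOptImprint_iff hη hfin] at h₁ h₂ ⊢
    intro k
    obtain ⟨u, rfl, hu⟩ := h₁ k
    obtain ⟨v, rfl, hv⟩ := h₂ k
    refine ⟨u ++ v, wordVal_append _ _ _, (hu.mul hR hv).trans ?_⟩
    rw [← map_mul]
    exact canonLE_map ρ (upLang_mul_le k u v)
  pol_closure e f h he hf := by
    rw [mem_pointedOptImprint_iff hη hfin] at h ⊢
    intro k
    obtain ⟨w, rfl, hw⟩ := h k
    refine ⟨_, wordVal_flatten_replicate he rfl k, ?_⟩
    -- Only `α(w)` is known to be idempotent; but then `w` and `ww` have the same `α`-value, hence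
    -- lie in one class of `C`.
    have hidem : IsIdempotentElem (wordVal η w) := by
      rw [IsIdempotentElem, ← wordVal_append, ← mono_nil_right_iff, ← mem_monoLang,
        ← hcls.eq_monoLang hη]
      exact hcls.fiber_le _ ((wordVal_append α w w).trans he)
    refine CanonLE.trans ?_ (canonLE_map ρ (upLang_pow_mul_le k hidem))
    rw [map_mul, map_mul, hcls.eq_monoLang hη]
    have := canonLE_map_pow hR hf hw k
    exact (this.mul hR (hR _)).mul hR this

end Soundness

/-! ### Two-sided ideals in finite monoids -/

section Rank

variable {T : Type v} [Monoid T]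

lemma exists_pow_isIdempotentElem [Finite T] (x : T) : ∃ n, IsIdempotentElem (x ^ (n + 1)) := by
  obtain ⟨i, j, hne, hij⟩ := Finite.exists_ne_map_eq_of_infinite fun n : ℕ => x ^ n
  wlog hlt : i < j generalizing i j
  · exact this j i hne.symm hij.symm (by omega)
  obtain ⟨p, rfl⟩ := Nat.exists_eq_add_of_lt hlt
  have hstep : ∀ t m, i ≤ m → x ^ (m + t * (p + 1)) = x ^ m := by
    intro t m hm
    obtain ⟨m, rfl⟩ := Nat.exists_eq_add_of_le hm
    induction t with
    | zero => simp
    | succ t ih =>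
      calc x ^ (i + m + (t + 1) * (p + 1)) = x ^ (i + p + 1) * x ^ (m + t * (p + 1)) := by
            rw [← pow_add]; congr 1; ring
        _ = x ^ (i + m + t * (p + 1)) := by
            rw [← show x ^ i = x ^ (i + p + 1) from hij, ← pow_add]; congr 1; ring
        _ = _ := ih
  -- The exponent `(i + 1) * (p + 1)` is a multiple of the period `p + 1` and is at least the
  -- preperiod `i`.
  refine ⟨(i + 1) * (p + 1) - 1, ?_⟩
  rw [Nat.sub_add_cancel (Nat.mul_pos (by omega) (by omega)), IsIdempotentElem, ← pow_add]
  exact hstep _ _ (by nlinarith)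

lemma eq_pow_mul_mul_pow {p b x : T} (h : b = p * b * x) (n : ℕ) : b = p ^ n * b * x ^ n := by
  induction n with
  | zero => simp
  | succ n ih =>
    calc b = p ^ n * (p * b * x) * x ^ n := by rw [← h]; exact ih
      _ = p ^ (n + 1) * b * x ^ (n + 1) := by simp only [pow_succ p, pow_succ' x, mul_assoc]

/-- Iterating gives `b = p ^ n * b * x ^ n`; at an exponent where the power of `p` is idempotent,
that power fixes `b` and can be dropped. -/
lemma exists_eq_mul_pow [Finite T] {p b x : T} (h : b = p * b * x) :
    ∃ n, b = b * x ^ (n + 1) := by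
  obtain ⟨n, hn⟩ := exists_pow_isIdempotentElem p
  have hb := eq_pow_mul_mul_pow h (n + 1)
  have hp : p ^ (n + 1) * b = b := by
    conv_lhs => rw [hb, ← mul_assoc, ← mul_assoc, hn.eq]
    exact hb.symm
  exact ⟨n, by rwa [hp] at hb⟩

lemma exists_eq_pow_mul [Finite T] {p b x : T} (h : b = p * b * x) :
    ∃ n, b = p ^ (n + 1) * b := by
  obtain ⟨n, hn⟩ := exists_pow_isIdempotentElem x
  have hb := eq_pow_mul_mul_pow h (n + 1)
  have hx : b * x ^ (n + 1) = b := by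
    conv_lhs => rw [hb, mul_assoc, hn.eq]
    exact hb.symm
  exact ⟨n, by rwa [mul_assoc, hx] at hb⟩

/-- The number of elements of the two-sided ideal generated by `t`. -/
noncomputable def idealRank (t : T) : ℕ := {x : T | ∃ p q, x = p * t * q}.ncard

variable [Finite T]

lemma idealRank_pos (t : T) : 0 < idealRank t :=
  (Set.ncard_pos).2 ⟨t, 1, 1, by simp⟩

lemma idealRank_le_card (t : T) : idealRank t ≤ Nat.card T := by
  rw [← Set.ncard_univ]
  exact Set.ncard_le_ncard (Set.subset_univ _)

lemma idealRank_mul_mul_le (p t q : T) : idealRank (p * t * q) ≤ idealRank t := by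
  refine Set.ncard_le_ncard ?_
  rintro _ ⟨p', q', rfl⟩
  exact ⟨p' * p, q * q', by simp only [mul_assoc]⟩

lemma idealRank_mul_le_right (s t : T) : idealRank (s * t) ≤ idealRank t := by
  simpa using idealRank_mul_mul_le s t 1

lemma exists_eq_mul_mul_of_idealRank_le {t p q : T} (h : idealRank t ≤ idealRank (p * t * q)) :
    ∃ p' q', t = p' * (p * t * q) * q' := by
  have hsub : {x : T | ∃ p' q', x = p' * (p * t * q) * q'} ⊆
      {x : T | ∃ p' q', x = p' * t * q'} := by
    rintro _ ⟨p', q', rfl⟩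
    exact ⟨p' * p, q * q', by simp only [mul_assoc]⟩
  exact (Set.eq_of_subset_of_ncard_le hsub h).ge ⟨1, 1, by simp⟩

/-- Stability of finite monoids: a right multiple of `b` generating the same two-sided ideal also
generates the same right ideal. -/
lemma exists_eq_mul_right_of_idealRank_le {b y : T} (h : idealRank b ≤ idealRank (b * y)) :
    ∃ z, b = b * y * z := by
  obtain ⟨p, q, hpq⟩ := exists_eq_mul_mul_of_idealRank_le (t := b) (p := 1) (q := y) (by simpa)
  obtain ⟨n, hn⟩ := exists_eq_mul_pow (p := p) (b := b) (x := y * q)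
    (by simpa [mul_assoc] using hpq)
  exact ⟨q * (y * q) ^ n, hn.trans (by rw [pow_succ']; simp only [mul_assoc])⟩

lemma exists_eq_mul_left_of_idealRank_le {c y : T} (h : idealRank c ≤ idealRank (y * c)) :
    ∃ z, c = z * y * c := by
  obtain ⟨p, q, hpq⟩ := exists_eq_mul_mul_of_idealRank_le (t := c) (p := y) (q := 1) (by simpa)
  obtain ⟨n, hn⟩ := exists_eq_pow_mul (p := p * y) (b := c) (x := q)
    (by simpa [mul_assoc] using hpq)
  exact ⟨(p * y) ^ n * p, hn.trans (by rw [pow_succ]; simp only [mul_assoc])⟩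

end Rank

/-! ### Evaluating all words at bounded cost -/

section Valuations

variable {A : Type u} {T : Type v} [Monoid T]

/-- `G k w t` states that `t` is a value of the word `w` of complexity at most `k`, and `H w t` that
`t` is a possible value of `w`. Besides products, a factor between two values which it stabilizes can
be evaluated at bounded cost. -/
structure IsValuation (G : ℕ → List A → T → Prop) (H : List A → T → Prop) : Prop where
  mono : ∀ {j k w t}, j ≤ k → G j w t → G k w t
  mul : ∀ {j k u v s t}, G j u s → G k v t → G (j + k + 1) (u ++ v) (s * t)
  exists_nil : ∃ t, G 0 [] t
  possible : ∀ {k w t}, G k w t → H w t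
  possible_nil : H [] 1
  possible_mul : ∀ {u v s t}, H u s → H v t → H (u ++ v) (s * t)
  block : ∀ {j k u w v b m c z}, b = b * m * c * z → c = c * z * m * c → G j u b → H w m →
    G k v c → ∃ h, G (j + k + 2) (u ++ w ++ v) (b * h * m * c)

variable [Finite T] {G : ℕ → List A → T → Prop} {H : List A → T → Prop}

/-- By stability `b = b * m * c * z` and `c = y * b * m * c`, whence the identities required by
`block`. The value obtained may differ from `b * m * c`, but it is a left multiple of it, so a right
factor that lowers the rank of `b * m * c` also lowers the rank of the value. -/
lemma IsValuation.exists_block (hG : IsValuation G H) {k : ℕ} {u w v : List A} {b m c : T}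
    (hb : idealRank b ≤ idealRank (b * m * c)) (hc : idealRank c ≤ idealRank (b * m * c))
    (hub : G k u b) (hwm : H w m) (hvc : G k v c) :
    ∃ s, G (2 * k + 2) (u ++ w ++ v) s ∧
      ∀ t, idealRank (s * t) ≤ idealRank (b * m * c * t) := by
  obtain ⟨z, hz⟩ := exists_eq_mul_right_of_idealRank_le (b := b) (y := m * c)
    (by rwa [← mul_assoc])
  obtain ⟨y, hy⟩ := exists_eq_mul_left_of_idealRank_le (c := c) (y := b * m) hc
  rw [← mul_assoc b] at hz
  have hcz : c = c * z * m * c := by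
    calc c = y * (b * m * c * z) * m * c := by rw [← hz, mul_assoc y]; exact hy
      _ = (y * (b * m) * c) * z * m * c := by simp only [mul_assoc]
      _ = _ := by rw [← hy]
  obtain ⟨h, hh⟩ := hG.block hz hcz hub hwm hvc
  refine ⟨_, by rw [two_mul]; exact hh, fun t => ?_⟩
  have : b * h * m * c * t = b * h * m * y * (b * m * c * t) := by
    conv_lhs => rw [hy]
    simp only [mul_assoc]
  rw [this]
  exact idealRank_mul_le_right _ _

/-- An unfinished factor in the scan of a sequence of values of rank at most `d + 1`: it is empty, a
single value, or a block whose product still has rank `d + 1`. -/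
def IsPending (G : ℕ → List A → T → Prop) (H : List A → T → Prop) (d k : ℕ) (u : List A) : Prop :=
  u = [] ∨ (∃ b, G k u b ∧ d < idealRank b ∧ idealRank b ≤ d + 1) ∨
    ∃ u₁ w u₂ b m c, u = u₁ ++ w ++ u₂ ∧ G k u₁ b ∧ H w m ∧ G k u₂ c ∧ d < idealRank (b * m * c) ∧
      idealRank b ≤ d + 1 ∧ idealRank c ≤ d + 1

/-- A sequence of values of rank at most `d + 1` can be grouped into values of rank at most `d`,
followed by a pending factor. -/
lemma IsValuation.exists_grouping (hG : IsValuation G H) {d k : ℕ} (L : List (List A × T))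
    (hL : ∀ p ∈ L, G k p.1 p.2 ∧ idealRank p.2 ≤ d + 1) :
    ∃ (L' : List (List A × T)) (u : List A),
      (∀ p ∈ L', G (3 * k + 3) p.1 p.2 ∧ idealRank p.2 ≤ d) ∧
      (L.map Prod.fst).flatten = (L'.map Prod.fst).flatten ++ u ∧ IsPending G H d k u := by
  induction L using List.reverseRecOn with
  | nil => exact ⟨[], [], by simp, by simp, .inl rfl⟩
  | append_singleton L q ih =>
    obtain ⟨L', u, hL', hflat, hu⟩ := ih fun p hp => hL p (by simp [hp])
    obtain ⟨v, t⟩ := q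
    obtain ⟨hv, ht⟩ := hL (v, t) (by simp)
    have push : ∀ s, G (3 * k + 3) (u ++ v) s → idealRank s ≤ d →
        ∃ (L' : List (List A × T)) (u : List A),
          (∀ p ∈ L', G (3 * k + 3) p.1 p.2 ∧ idealRank p.2 ≤ d) ∧
          ((L ++ [(v, t)]).map Prod.fst).flatten = (L'.map Prod.fst).flatten ++ u ∧
          IsPending G H d k u := fun s hs hsd => by
      refine ⟨L' ++ [(u ++ v, s)], [], fun p hp => ?_, by simp [hflat], .inl rfl⟩
      rcases List.mem_append.1 hp with hp | hp
      · exact hL' p hp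
      · rw [List.mem_singleton.1 hp]
        exact ⟨hs, hsd⟩
    have keep : IsPending G H d k (u ++ v) →
        ∃ (L' : List (List A × T)) (u : List A),
          (∀ p ∈ L', G (3 * k + 3) p.1 p.2 ∧ idealRank p.2 ≤ d) ∧
          ((L ++ [(v, t)]).map Prod.fst).flatten = (L'.map Prod.fst).flatten ++ u ∧
          IsPending G H d k u := fun h => ⟨L', u ++ v, hL', by simp [hflat], h⟩
    rcases hu with rfl | ⟨b, hb, hdb, hbd⟩ | ⟨u₁, w, u₂, b, m, c, rfl, hb, hm, hc, hd, hbd, hcd⟩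
    · by_cases htd : idealRank t ≤ d
      · exact push t (hG.mono (by omega) hv) htd
      · exact keep (.inr (.inl ⟨t, hv, by omega, ht⟩))
    · by_cases htd : idealRank (b * t) ≤ d
      · exact push _ (hG.mono (by omega) (hG.mul hb hv)) htd
      · exact keep (.inr (.inr ⟨u, [], v, b, 1, t, by simp, hb, hG.possible_nil, hv,
          by simpa using htd, hbd, ht⟩))
    · by_cases htd : idealRank (b * m * c * t) ≤ d
      · obtain ⟨s, hs, hst⟩ := hG.exists_block (by omega) (by omega) hb hm hc
        -- The rank has dropped, so the group is closed. Its cost is `2 * k + 2` for the block, `k`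
        -- for `v` and `1` for the product, which is the `3 * k + 3` of the statement.
        exact push _ (hG.mono (by omega) (hG.mul hs hv)) ((hst t).trans htd)
      -- The old right end `c` joins the middle, of which only a possible value is remembered. The
      -- cost of a block is thus independent of its length.
      · refine keep (.inr (.inr ⟨u₁, w ++ u₂, v, b, m * c, t, by simp, hb,
          hG.possible_mul hm (hG.possible hc), hv, ?_, hbd, ht⟩))
        rw [← mul_assoc]
        omega

lemma IsPending.exists_value (hG : IsValuation G H) {d k : ℕ} {u : List A}
    (h : IsPending G H d k u) : u = [] ∨ ∃ s, G (3 * k + 3) u s := by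
  rcases h with rfl | ⟨b, hb, -, -⟩ | ⟨u₁, w, u₂, b, m, c, rfl, hb, hm, hc, hd, hbd, hcd⟩
  · exact .inl rfl
  · exact .inr ⟨b, hG.mono (by omega) hb⟩
  · obtain ⟨s, hs, -⟩ := hG.exists_block (by omega) (by omega) hb hm hc
    exact .inr ⟨s, hG.mono (by omega) hs⟩

/-- Ranks are positive, so `d = 0` leaves only the empty sequence. Grouping lowers `d` by one and
turns `k` into `3 * k + 3`, and the pending factor adds at most `3 * k + 4`; the bound is chosen to
absorb both. -/
lemma IsValuation.exists_value_of_idealRank_le (hG : IsValuation G H) (d k : ℕ)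
    (L : List (List A × T)) (hL : ∀ p ∈ L, G k p.1 p.2 ∧ idealRank p.2 ≤ d) :
    ∃ t, G (3 * 4 ^ d * (k + 2)) (L.map Prod.fst).flatten t := by
  induction d generalizing k L with
  | zero =>
    cases L with
    | nil =>
      obtain ⟨t, ht⟩ := hG.exists_nil
      exact ⟨t, hG.mono (by omega) ht⟩
    | cons p L =>
      have := (hL p (by simp)).2
      have := idealRank_pos p.2
      omega
  | succ d ih =>
    obtain ⟨L', u, hL', hflat, hu⟩ := hG.exists_grouping L hL
    obtain ⟨t, ht⟩ := ih _ L' hL'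
    have h4 : 1 ≤ 4 ^ d := Nat.one_le_pow _ _ (by norm_num)
    rw [hflat]
    rcases hu.exists_value hG with rfl | ⟨s, hs⟩
    · refine ⟨t, hG.mono ?_ (by simpa using ht)⟩
      rw [pow_succ]
      nlinarith
    · refine ⟨t * s, hG.mono ?_ (hG.mul ht hs)⟩
      rw [pow_succ]
      nlinarith

/-- If all letters have a value of complexity at most `k`, then all words have a value of bounded
complexity. -/
theorem IsValuation.exists_value (hG : IsValuation G H) {k : ℕ} (hk : ∀ a : A, ∃ t, G k [a] t)
    (w : List A) : ∃ t, G (3 * 4 ^ Nat.card T * (k + 2)) w t := by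
  choose f hf using hk
  obtain ⟨t, ht⟩ := hG.exists_value_of_idealRank_le (Nat.card T) k (w.map fun a => ([a], f a)) (by
    intro p hp
    obtain ⟨a, -, rfl⟩ := List.mem_map.1 hp
    exact ⟨hf a, idealRank_le_card _⟩)
  refine ⟨t, ?_⟩
  have hflat : ((w.map fun a => ([a], f a)).map Prod.fst).flatten = w := by
    clear ht
    induction w with
    | nil => rfl
    | cons a w ih => simpa using ih
  rwa [hflat] at ht

end Valuations

/-! ### Every saturated set contains the optimal imprint -/

section Completeness

variable {A : Type u} {M : Type w} [Monoid M] {R : Type x} [NonUnitalSemiring R]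

/-- The elements of `S` lying below a class of the canonical equivalence, on which the image of the
empty word acts as a unit. -/
structure IsPointed (α : FreeMonoid A →* M) (cls : M → Language A) (ρ : Language A →ₙ+* R)
    (S : Set (M × R)) (t : M × R) : Prop where
  mem : t ∈ S
  exists_word : ∃ w, wordVal α w = t.1
  le_cls : CanonLE t.2 (ρ (cls t.1))
  one_mul : ρ 1 * t.2 = t.2
  mul_one : t.2 * ρ 1 = t.2

variable {N : Type v} [Monoid N] {C : Set (Language A)} {η : FreeMonoid A →* N}
  {α : FreeMonoid A →* M} {cls : M → Language A} {ρ : Language A →ₙ+* R} {S : Set (M × R)}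

lemma IsClassMap.mul_le (hcls : IsClassMap C α cls) (hη : IsClassMorphism C η) {s t : M}
    (hs : ∃ w, wordVal α w = s) (ht : ∃ w, wordVal α w = t) : cls s * cls t ≤ cls (s * t) := by
  obtain ⟨u, rfl⟩ := hs
  obtain ⟨v, rfl⟩ := ht
  rw [← wordVal_append, hcls.eq_monoLang hη, hcls.eq_monoLang hη, hcls.eq_monoLang hη]
  rintro _ ⟨p, hp, q, hq, rfl⟩
  refine mono_nil_right_iff.2 ?_
  rw [wordVal_append, wordVal_append, mono_nil_right_iff.1 hp, mono_nil_right_iff.1 hq]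

lemma isPointed_of_word (hS : IsPolSaturated α cls ρ S) (hcls : IsClassMap C α cls)
    (hR : ∀ r : R, r + r = r) (w : List A) :
    IsPointed α cls ρ S (wordVal α w, ρ ({w} : Language A)) where
  mem := hS.trivial_subset ⟨w, rfl, hR _⟩
  exists_word := ⟨w, rfl⟩
  le_cls := canonLE_map ρ fun v hv => hcls.fiber_le _ (by obtain rfl : v = w := hv; rfl)
  one_mul := by rw [← map_mul, _root_.one_mul]
  mul_one := by rw [← map_mul, _root_.mul_one]

lemma IsPointed.mul (hS : IsPolSaturated α cls ρ S) (hcls : IsClassMap C α cls)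
    (hη : IsClassMorphism C η) (hR : ∀ r : R, r + r = r) {s t : M × R}
    (hs : IsPointed α cls ρ S s) (ht : IsPointed α cls ρ S t) : IsPointed α cls ρ S (s * t) where
  mem := hS.mul_mem _ _ _ _ hs.mem ht.mem
  exists_word := by
    obtain ⟨u, hu⟩ := hs.exists_word
    obtain ⟨v, hv⟩ := ht.exists_word
    exact ⟨u ++ v, by rw [wordVal_append, hu, hv]; rfl⟩
  le_cls := by
    refine (hs.le_cls.mul hR ht.le_cls).trans ?_
    rw [← map_mul]
    exact canonLE_map ρ (hcls.mul_le hη hs.exists_word ht.exists_word)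
  one_mul := by rw [Prod.snd_mul, ← mul_assoc, hs.one_mul]
  mul_one := by rw [Prod.snd_mul, mul_assoc, ht.mul_one]

/-- The bound by the class survives because the class of an idempotent is closed under
concatenation. -/
lemma IsPointed.closure (hS : IsPolSaturated α cls ρ S) (hcls : IsClassMap C α cls)
    (hη : IsClassMorphism C η) (hR : ∀ r : R, r + r = r) {t : M × R}
    (ht : IsPointed α cls ρ S t) (hidem : IsIdempotentElem t) :
    IsPointed α cls ρ S (t.1, t.2 * ρ (cls t.1) * t.2) where
  mem := hS.pol_closure _ _ ht.mem (congrArg Prod.fst hidem) (congrArg Prod.snd hidem)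
  exists_word := ht.exists_word
  le_cls := by
    have hidem₁ : t.1 * t.1 = t.1 := congrArg Prod.fst hidem
    have hle := hcls.mul_le hη ht.exists_word ht.exists_word
    rw [hidem₁] at hle
    refine ((ht.le_cls.mul hR (hR _)).mul hR ht.le_cls).trans ?_
    rw [← map_mul, ← map_mul]
    exact canonLE_map ρ ((mul_le_mul' hle le_rfl).trans hle)
  one_mul := by simp only [← mul_assoc, ht.one_mul]
  mul_one := by simp only [mul_assoc, ht.mul_one]

/-- This is the `Pol(C)` closure of the idempotent given by the empty word. -/
lemma isPointed_monoLang_one (hS : IsPolSaturated α cls ρ S) (hcls : IsClassMap C α cls)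
    (hη : IsClassMorphism C η) (hR : ∀ r : R, r + r = r) :
    IsPointed α cls ρ S (1, ρ (monoLang η 1 [])) := by
  have h : IsPointed α cls ρ S (wordVal α [], ρ 1) := isPointed_of_word hS hcls hR []
  have hidem : IsIdempotentElem ((wordVal α [], ρ 1) : M × R) := by
    rw [IsIdempotentElem, Prod.mk_mul_mk, ← wordVal_append, ← map_mul, mul_one]; rfl
  have hcl := h.closure hS hcls hη hR hidem
  rwa [hcls.eq_monoLang hη, wordVal_nil, wordVal_nil, ← map_mul, ← map_mul, one_mul, mul_one] at hcl

lemma isPointed_monoLang_letter (hS : IsPolSaturated α cls ρ S) (hcls : IsClassMap C α cls)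
    (hη : IsClassMorphism C η) (hR : ∀ r : R, r + r = r) (a : A) :
    IsPointed α cls ρ S (wordVal α [a], ρ (monoLang η 1 [(a, 1)])) := by
  have h1 := isPointed_monoLang_one hS hcls hη hR
  have h := (h1.mul hS hcls hη hR (isPointed_of_word hS hcls hR [a])).mul hS hcls hη hR h1
  rwa [Prod.mk_mul_mk, Prod.mk_mul_mk, one_mul, mul_one, ← map_mul, ← map_mul,
    ← monoLang_append_mark, List.nil_append] at h

/-- The pointed elements of a saturated set form a monoid. -/
abbrev pointedMonoid (hS : IsPolSaturated α cls ρ S) (hcls : IsClassMap C α cls)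
    (hη : IsClassMorphism C η) (hR : ∀ r : R, r + r = r) :
    Monoid {t : M × R // IsPointed α cls ρ S t} where
  mul s t := ⟨s.1 * t.1, s.2.mul hS hcls hη hR t.2⟩
  mul_assoc s t u := Subtype.ext (mul_assoc s.1 t.1 u.1)
  -- `R` need not have a unit; the image of the empty word serves as one on pointed elements.
  one := ⟨(wordVal α [], ρ 1), isPointed_of_word hS hcls hR []⟩
  one_mul s := Subtype.ext (Prod.ext ((congrArg (fun t => t * s.1.1) (wordVal_nil α)).trans
    (one_mul _)) s.2.one_mul)
  mul_one s := Subtype.ext (Prod.ext ((congrArg (fun t => s.1.1 * t) (wordVal_nil α)).trans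
    (mul_one _)) s.2.mul_one)

lemma mul_mul_pow_mul_mul {T : Type*} [Monoid T] {m c z : T} (h : c = c * z * m * c) (n : ℕ) :
    c * z * (m * c * z) ^ n * m * c = c := by
  induction n with
  | zero => simpa using h.symm
  | succ n ih =>
    calc c * z * (m * c * z) ^ (n + 1) * m * c
        = (c * z * (m * c * z) ^ n * m * c) * z * m * c := by rw [pow_succ]; simp only [mul_assoc]
      _ = c := by rw [ih, ← h]

lemma mul_pow_eq_self {T : Type*} [Monoid T] {b y : T} (h : b = b * y) (n : ℕ) : b * y ^ n = b := by
  induction n with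
  | zero => simp
  | succ n ih => rw [pow_succ', ← mul_assoc, ← h, ih]

/-- Complexity counts marks, and a possible value of `w` only has to lie over `α(w)`. The substance
is `block`, where the middle word is left unmarked and its whole class is compensated by the
`Pol(C)` closure of an idempotent. -/
lemma isValuation_monoLang [Finite M] [Finite R] (hS : IsPolSaturated α cls ρ S)
    (hcls : IsClassMap C α cls) (hη : IsClassMorphism C η) (hR : ∀ r : R, r + r = r) :
    letI := pointedMonoid hS hcls hη hR
    IsValuation
      (fun k w (t : {t : M × R // IsPointed α cls ρ S t}) => wordVal α w = t.1.1 ∧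
        ∃ x l, l.length ≤ k ∧ Mono η w x l ∧ CanonLE (ρ (monoLang η x l)) t.1.2)
      (fun w t => wordVal α w = t.1.1) := by
  let _ := pointedMonoid hS hcls hη hR
  have hmul : ∀ s t : {t : M × R // IsPointed α cls ρ S t}, (s * t).1 = s.1 * t.1 :=
    fun _ _ => rfl
  refine
    { mono := ?_
      mul := ?_
      exists_nil := ?_
      possible := fun h => h.1
      possible_nil := rfl
      possible_mul := ?_
      block := ?_ }
  · rintro j k w t hjk ⟨hw, x, l, hl, h⟩
    exact ⟨hw, x, l, hl.trans hjk, h⟩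
  · rintro j k u v s t ⟨hu, x, l, hl, hul, hle⟩ ⟨hv, y, l', hl', hvl, hle'⟩
    obtain ⟨m, hm, hmono, hsub⟩ := hul.exists_append hvl
    refine ⟨by rw [wordVal_append, hu, hv]; rfl, x, m, by omega, hmono, ?_⟩
    refine (canonLE_map ρ hsub).trans ?_
    rw [map_mul]
    exact hle.mul hR hle'
  · exact ⟨⟨_, isPointed_monoLang_one hS hcls hη hR⟩, wordVal_nil α, 1, [], le_rfl, .nil, hR _⟩
  · intro u v s t hu hv
    rw [wordVal_append, hu, hv]; rfl
  · rintro j k u w v b m c z hbz hcz ⟨hu, x, l, hl, hul, hle⟩ hw ⟨hv, y, l', hl', hvl, hle'⟩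
    obtain ⟨l₁, hl₁, hmono₁, hsub₁⟩ := hul.exists_append (mono_wordVal w)
    obtain ⟨l₂, hl₂, hmono₂, hsub₂⟩ := hmono₁.exists_append hvl
    -- The idempotent `g` is a power of `m * c * z`, so `b * g = b`; the element `d` is chosen so
    -- that `m * d = g` and `d * g * m * c = c`.
    obtain ⟨n, hn⟩ := exists_pow_isIdempotentElem (m * c * z)
    obtain ⟨g, hg⟩ : ∃ g, g = (m * c * z) ^ (n + 1) := ⟨_, rfl⟩
    obtain ⟨d, hd⟩ : ∃ d, d = c * z * (m * c * z) ^ n := ⟨_, rfl⟩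
    rw [← hg] at hn
    have hbg : b * g = b := hg ▸ mul_pow_eq_self (by simpa only [mul_assoc] using hbz) _
    have hcd : d * g * m * c = c := by
      rw [hd, hg, mul_assoc (c * z), ← pow_add]
      exact mul_mul_pow_mul_mul hcz _
    have hmd : m * d = g := by
      rw [hd, hg, pow_succ']; simp only [mul_assoc]
    -- The factor `h` is the closure of `g`. The two extra marks attach `w` to `u` and `v` to the
    -- result.
    refine ⟨⟨_, g.2.closure hS hcls hη hR ((hmul g g).symm.trans (congrArg _ hn))⟩, ?_, x, l₂,
      by simp at hl₁; omega, hmono₂, ?_⟩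
    · have h1 : b.1.1 * g.1.1 = b.1.1 := congrArg (fun t => t.1.1) hbg
      simp only [hmul, Prod.fst_mul, wordVal_append, hu, hv, hw, h1]
    · have hub : CanonLE (ρ (monoLang η x l₂)) (b.1.2 * ρ (cls m.1.1) * c.1.2) := by
        refine (canonLE_map ρ (hsub₂.trans (mul_le_mul' hsub₁ le_rfl))).trans ?_
        rw [map_mul, map_mul, ← hw, hcls.eq_monoLang hη]
        exact (hle.mul hR (hR _)).mul hR hle'
      refine hub.trans ?_
      have hb2 : b.1.2 * g.1.2 = b.1.2 := congrArg (fun t => t.1.2) hbg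
      have hc2 : d.1.2 * g.1.2 * m.1.2 * c.1.2 = c.1.2 := congrArg (fun t => t.1.2) hcd
      have hmd1 : m.1.1 * d.1.1 = g.1.1 := congrArg (fun t => t.1.1) hmd
      have refl : ∀ r : R, CanonLE r r := hR
      -- Here the bound of pointed elements by their class is used: `d` is replaced by its class,
      -- and the classes of `m` and `d` multiply into that of `g`.
      have key : CanonLE (ρ (cls m.1.1) * d.1.2) (ρ (cls g.1.1)) := by
        refine ((refl (ρ (cls m.1.1))).mul hR d.2.le_cls).trans ?_
        rw [← map_mul, ← hmd1]
        exact canonLE_map ρ (hcls.mul_le hη m.2.exists_word d.2.exists_word)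
      have heq : b.1.2 * ρ (cls m.1.1) * c.1.2 =
          b.1.2 * (g.1.2 * (ρ (cls m.1.1) * d.1.2) * g.1.2) * m.1.2 * c.1.2 := by
        conv_lhs => rw [← hb2, ← hc2]
        simp only [mul_assoc]
      rw [heq]
      simp only [hmul, Prod.snd_mul]
      exact (((refl _).mul hR (((refl _).mul hR key).mul hR (refl _))).mul hR (refl _)).mul hR
        (refl _)

/-- A saturated set contains the images of the languages `upLang η k w`, for an explicit `k`. -/
theorem upLang_mem_of_isPolSaturated [Finite M] [Finite R] (hS : IsPolSaturated α cls ρ S)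
    (hcls : IsClassMap C α cls) (hη : IsClassMorphism C η) (hR : ∀ r : R, r + r = r)
    {k : ℕ} (hk : 9 * 4 ^ (Nat.card M * Nat.card R) ≤ k) (w : List A) :
    (wordVal α w, ρ (upLang η k w)) ∈ S := by
  let _ := pointedMonoid hS hcls hη hR
  have hval := isValuation_monoLang hS hcls hη hR
  -- A letter costs one mark, so the general bound becomes `3 * 4 ^ _ * (1 + 2)`, hence the `9`.
  obtain ⟨t, hw, x, l, hl, hwl, hle⟩ := hval.exists_value (k := 1) (fun a =>
    ⟨⟨_, isPointed_monoLang_letter hS hcls hη hR a⟩, rfl, 1, [(a, 1)], le_rfl,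
      .mark _ _ _ _ .nil, hR _⟩) w
  rw [hw]
  refine hS.downset _ _ _ t.2.mem ((canonLE_map ρ fun v hv => ?_).trans hle)
  refine hv x l (hl.trans (le_trans ?_ hk)) hwl
  have : Nat.card {t : M × R // IsPointed α cls ρ S t} ≤ Nat.card M * Nat.card R := by
    rw [← Nat.card_prod]
    exact Finite.card_subtype_le _
  calc 3 * 4 ^ _ * 3 = 9 * 4 ^ _ := by ring
    _ ≤ _ := by gcongr; norm_num

theorem isLeast_pointedOptImprint [Finite A] [Finite N] [Finite M] [Finite R]
    {C : BooleanSubalgebra (Language A)} (hfin : (C : Set (Language A)).Finite)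
    (hη : IsClassMorphism (C : Set (Language A)) η)
    (hcls : IsClassMap (C : Set (Language A)) α cls) (hR : ∀ r : R, r + r = r) :
    IsLeast {S : Set (M × R) | IsPolSaturated α cls ρ S}
      (pointedOptImprint (Pol (C : Set (Language A))) α ρ) := by
  refine ⟨isPolSaturated_pointedOptImprint hη hfin hcls hR, fun S hS => ?_⟩
  rintro ⟨s, r⟩ h
  obtain ⟨w, rfl, hr⟩ := (mem_pointedOptImprint_iff hη hfin).1 h _
  exact hS.downset _ _ _ (upLang_mem_of_isPolSaturated hS hcls hη hR le_rfl w) hr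

end Completeness

/-! ### The rating map of a morphism -/

section RatingOfMorphism

variable {A : Type u} {M : Type w} [Monoid M]

/-- The rating map sending a language to its image under a morphism. -/
def imageRating (α : FreeMonoid A →* M) : Language A →ₙ+* SetSemiring M where
  toFun K := Set.up (wordVal α '' {w | w ∈ K})
  map_zero' := by
    rw [← Set.up_empty]
    congr 1
    ext s
    simp
  map_add' K L := by
    rw [← Set.up_union, ← Set.image_union]
    rfl
  map_mul' K L := by
    rw [← Set.up_mul]
    congr 1
    ext s
    simp only [Set.mem_image, Set.mem_ofPred_eq, Set.mem_mul, Language.mem_mul]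
    constructor
    · rintro ⟨_, ⟨u, hu, v, hv, rfl⟩, rfl⟩
      exact ⟨_, ⟨u, hu, rfl⟩, _, ⟨v, hv, rfl⟩, (wordVal_append α u v).symm⟩
    · rintro ⟨_, ⟨u, hu, rfl⟩, _, ⟨v, hv, rfl⟩, rfl⟩
      exact ⟨_, ⟨u, hu, v, hv, rfl⟩, wordVal_append α u v⟩

lemma mem_of_canonLE_imageRating {α : FreeMonoid A →* M} {K L : Language A}
    (h : CanonLE (imageRating α K) (imageRating α L)) {v : List A} (hv : v ∈ K) :
    ∃ v' ∈ L, wordVal α v' = wordVal α v := by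
  have hv' : wordVal α v ∈ SetSemiring.down (imageRating α L + imageRating α K) :=
    Or.inr ⟨v, hv, rfl⟩
  rw [show imageRating α L + imageRating α K = imageRating α L from h] at hv'
  exact hv'

end RatingOfMorphism

/-! ### An effective criterion for covering -/

section Criterion

variable {A : Type u} [Finite A] {N : Type v} [Monoid N] [Finite N] {M : Type w} [Monoid M]
  [Finite M] {C : BooleanSubalgebra (Language A)} {η : FreeMonoid A →* N} {α : FreeMonoid A →* M}

open Classical in
lemma exists_isClassMap {A : Type u} {N : Type v} [Monoid N] {M : Type w} [Monoid M]
    {C : Set (Language A)} {η : FreeMonoid A →* N} {α : FreeMonoid A →* M}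
    (hη : IsClassMorphism C η)
    (hα : ∀ u v, wordVal α u = wordVal α v → wordVal η u = wordVal η v) :
    ∃ cls, IsClassMap C α cls := by
  -- For `s` outside the image of `α` the fibre is empty and any class will do.
  refine ⟨fun s => if h : ∃ w, wordVal α w = s then simClass C h.choose else simClass C [],
    fun s => ?_, fun s v hv => ?_⟩
  · by_cases h : ∃ w, wordVal α w = s
    · exact ⟨h.choose, dif_pos h⟩
    · exact ⟨[], dif_neg h⟩
  · have h : ∃ w, wordVal α w = s := ⟨v, hv⟩
    simp only [dif_pos h]
    exact (hη.wordVal_eq_iff _ _).1 (hα _ _ (h.choose_spec.trans hv.symm))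

/-- Covering of languages recognized by `α` is decided by the preorder `MonoLE η k` for an explicit
`k`. -/
theorem isCoverable_pol_iff (hfin : (C : Set (Language A)).Finite)
    (hη : IsClassMorphism (C : Set (Language A)) η)
    (hα : ∀ u v, wordVal α u = wordVal α v → wordVal η u = wordVal η v)
    {L : Language A} {Ls : Set (Language A)}
    (hL : ∀ u v, wordVal α u = wordVal α v → u ∈ L → v ∈ L)
    (hLs : ∀ K ∈ Ls, ∀ u v, wordVal α u = wordVal α v → u ∈ K → v ∈ K)
    {k : ℕ} (hk : 9 * 4 ^ (Nat.card M * 2 ^ Nat.card M) ≤ k) :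
    IsCoverable (Pol (C : Set (Language A))) L Ls ↔
      ∀ w ∈ L, ∃ K ∈ Ls, ∀ v ∈ K, ¬ MonoLE η k w v := by
  constructor
  · rintro ⟨Ks, hKs, hsep⟩ w hw
    by_contra! hcon
    obtain ⟨cls, hcls⟩ := exists_isClassMap hη hα
    have : Finite (SetSemiring M) := inferInstanceAs (Finite (Set M))
    have hcard : Nat.card (SetSemiring M) = 2 ^ Nat.card M := by
      have := Fintype.ofFinite M
      change Nat.card (Set M) = _
      simp
    have hR : ∀ r : SetSemiring M, r + r = r := fun r => Set.union_self r.down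
    have hsat := isPolSaturated_pointedOptImprint (ρ := imageRating α) hη hfin hcls hR
    -- Completeness is applied to the optimal imprint itself: for every level `j`, some `w'` with
    -- the `α`-value of `w` has a language `upLang η j w'` whose image contains that of `upLang η k
    -- w`. Level `k` thus controls all covers.
    have hmem := upLang_mem_of_isPolSaturated hsat hcls hη hR (k := k) (by rwa [hcard]) w
    obtain ⟨j, hj⟩ := hKs.exists_upLang_le hη
    obtain ⟨w', hw', hle⟩ := (mem_pointedOptImprint_iff hη hfin).1 hmem j
    obtain ⟨K, hK, hsub⟩ := hj w' (hL _ _ hw'.symm hw)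
    obtain ⟨L', hL', hdisj⟩ := hsep K hK
    obtain ⟨v, hv, hwv⟩ := hcon L' hL'
    obtain ⟨v', hv', hvv'⟩ := mem_of_canonLE_imageRating hle (v := v) hwv
    exact Set.disjoint_left.1 hdisj (hsub hv') (hLs _ hL' _ _ hvv'.symm hv)
  · intro h
    refine ⟨_, isCover_upLang hη hfin k L, ?_⟩
    rintro _ ⟨w, hw, rfl⟩
    obtain ⟨K, hK, hdisj⟩ := h w hw
    exact ⟨K, hK, Set.disjoint_left.2 fun v hv hvK => hdisj v hvK hv⟩

/-- Along a left-compatible map into a finite type, every word is equivalent to a short one. -/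
lemma exists_short_word {A : Type u} {F : Type v} [Finite F] {f : List A → F}
    (hf : ∀ a u v, f u = f v → f (a :: u) = f (a :: v)) (w : List A) :
    ∃ w', w'.length ≤ Nat.card F ∧ f w' = f w := by
  have happ : ∀ p u v, f u = f v → f (p ++ u) = f (p ++ v) := by
    intro p u v h
    induction p with
    | nil => exact h
    | cons a p ih => exact hf a _ _ ih
  induction hn : w.length using Nat.strong_induction_on generalizing w with
  | _ n ih =>
    subst hn
    by_cases hw : w.length ≤ Nat.card F
    · exact ⟨w, hw, rfl⟩
    · have := Fintype.ofFinite F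
      obtain ⟨i, j, hne, hij⟩ := Fintype.exists_ne_map_eq_of_card_lt
        (fun i : Fin w.length => f (w.drop i)) (by simpa [Nat.card_eq_fintype_card] using hw)
      wlog hlt : i < j generalizing i j
      · exact this j i hne.symm hij.symm (by omega)
      have hlen : (w.take i ++ w.drop j).length < w.length := by
        simp only [List.length_append, List.length_take, List.length_drop]
        omega
      obtain ⟨w', hw', hfw'⟩ := ih _ hlen _ rfl
      refine ⟨w', hw', hfw'.trans ?_⟩
      conv_rhs => rw [← List.take_append_drop i w]
      exact happ _ _ _ hij.symm

/-- A list of at most `k` entries is determined by its first `k` optional entries, whence the `+ 1`.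
-/
lemma card_monomials_le {A : Type u} {N : Type v} [Finite A] [Finite N] (k : ℕ) :
    Nat.card {m : N × List (A × N) | m.2.length ≤ k} ≤
      Nat.card N * (Nat.card A * Nat.card N + 1) ^ k := by
  have hinj : Function.Injective (fun m : {m : N × List (A × N) | m.2.length ≤ k} =>
      (m.1.1, fun i : Fin k => m.1.2[(i : ℕ)]?)) := by
    rintro ⟨⟨x, l⟩, hl⟩ ⟨⟨y, l'⟩, hl'⟩ h
    simp only [Prod.mk.injEq] at h
    obtain ⟨rfl, h⟩ := h
    have : l = l' := by
      refine List.ext_getElem? fun i => ?_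
      by_cases hi : i < k
      · exact congrFun h ⟨i, hi⟩
      · simp only [Set.mem_ofPred_eq] at hl hl'
        rw [List.getElem?_eq_none (by omega), List.getElem?_eq_none (by omega)]
    subst this
    rfl
  refine (Nat.card_le_card_of_injective _ hinj).trans_eq ?_
  rw [Nat.card_prod, Nat.card_fun, Finite.card_option, Nat.card_prod, Nat.card_fin]

/-- Every word is equivalent to a word of bounded length, for both `α` and `MonoLE η k`. -/
lemma exists_short_equivalent (η : FreeMonoid A →* N) (α : FreeMonoid A →* M) (k : ℕ)
    (w : List A) :
    ∃ w', w'.length ≤ Nat.card M * 2 ^ (Nat.card N * (Nat.card A * Nat.card N + 1) ^ k) ∧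
      wordVal α w' = wordVal α w ∧ MonoLE η k w w' ∧ MonoLE η k w' w := by
  have hF : Finite {m : N × List (A × N) | m.2.length ≤ k} := finite_monomials k
  let f : List A → M × Set {m : N × List (A × N) | m.2.length ≤ k} :=
    fun w => (wordVal α w, {m | Mono η w m.1.1 m.1.2})
  have hle : ∀ u v, f u = f v → MonoLE η k u v := fun u v h x l hl hu =>
    (Set.ext_iff.1 (congrArg Prod.snd h) ⟨(x, l), hl⟩).1 hu
  have hf : ∀ a u v, f u = f v → f (a :: u) = f (a :: v) := by
    intro a u v h
    have h₁ := (MonoLE.refl k [a]).append (hle u v h)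
    have h₂ := (MonoLE.refl k [a]).append (hle v u h.symm)
    refine Prod.ext ?_ (Set.ext fun m => ⟨h₁ _ _ m.2, h₂ _ _ m.2⟩)
    have h₃ : wordVal α u = wordVal α v := congrArg Prod.fst h
    change wordVal α (a :: u) = wordVal α (a :: v)
    rw [wordVal_cons, h₃, ← wordVal_cons]
  obtain ⟨w', hw', hfw⟩ := exists_short_word hf w
  refine ⟨w', hw'.trans ?_, congrArg Prod.fst hfw, hle _ _ hfw.symm, hle _ _ hfw⟩
  have hset : Nat.card (Set {m : N × List (A × N) | m.2.length ≤ k}) =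
      2 ^ Nat.card {m : N × List (A × N) | m.2.length ≤ k} := by
    have := Fintype.ofFinite {m : N × List (A × N) | m.2.length ≤ k}
    simp
  rw [Nat.card_prod, hset]
  gcongr
  · norm_num
  · exact card_monomials_le k

lemma MonoLE.trans {A : Type u} {N : Type v} [Monoid N] {η : FreeMonoid A →* N} {k : ℕ}
    {u v w : List A} (h : MonoLE η k u v) (h' : MonoLE η k v w) :
    MonoLE η k u w := fun x l hl hu => h' x l hl (h x l hl hu)

/-- In the covering criterion, it suffices to consider words of bounded length. -/
theorem isCoverable_pol_iff_bounded (hfin : (C : Set (Language A)).Finite)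
    (hη : IsClassMorphism (C : Set (Language A)) η)
    (hα : ∀ u v, wordVal α u = wordVal α v → wordVal η u = wordVal η v)
    {L : Language A} {Ls : Set (Language A)}
    (hL : ∀ u v, wordVal α u = wordVal α v → u ∈ L → v ∈ L)
    (hLs : ∀ K ∈ Ls, ∀ u v, wordVal α u = wordVal α v → u ∈ K → v ∈ K)
    {k B : ℕ} (hk : 9 * 4 ^ (Nat.card M * 2 ^ Nat.card M) ≤ k)
    (hB : Nat.card M * 2 ^ (Nat.card N * (Nat.card A * Nat.card N + 1) ^ k) ≤ B) :
    IsCoverable (Pol (C : Set (Language A))) L Ls ↔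
      ∀ w, w.length ≤ B → w ∈ L → ∃ K ∈ Ls, ∀ v, v.length ≤ B → v ∈ K → ¬ MonoLE η k w v := by
  rw [isCoverable_pol_iff hfin hη hα hL hLs hk]
  constructor
  · intro h w _ hw
    obtain ⟨K, hK, hKw⟩ := h w hw
    exact ⟨K, hK, fun v _ hv => hKw v hv⟩
  · intro h w hw
    obtain ⟨w', hlen, hαw, hle, hle'⟩ := exists_short_equivalent η α k w
    obtain ⟨K, hK, hKw⟩ := h w' (hlen.trans hB) (hL _ _ hαw.symm hw)
    refine ⟨K, hK, fun v hv hwv => ?_⟩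
    obtain ⟨v', hlen', hαv, hvv', -⟩ := exists_short_equivalent η α k v
    exact hKw v' (hlen'.trans hB) (hLs K hK _ _ hαv.symm hv) ((hle'.trans hwv).trans hvv')

end Criterion

/-! ### One finite monoid recognizing all input languages -/

section Automata

variable {A : Type u} {N : Type v} [Monoid N]

/-- The automaton coded by `c`. -/
def NFACode.nfa (c : NFACode A) : NFA A ℕ where
  step := fun q a => {q' | (q, a, q') ∈ c.2.1}
  start := {q | q ∈ c.1}
  accept := {q | q ∈ c.2.2}

/-- The states of `c` which are initial or the target of a transition. -/
def NFACode.targets (c : NFACode A) : List ℕ := c.1 ++ c.2.1.map fun t => t.2.2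

/-- The pairs of an automaton in `cs` and one of its initial or target states. -/
def allTargets (cs : List (NFACode A)) : List (NFACode A × ℕ) :=
  cs.flatMap fun c => c.targets.map fun q => (c, q)

lemma NFACode.mem_targets {c : NFACode A} {w : List A} {q : ℕ}
    (h : q ∈ c.nfa.evalFrom c.nfa.start w) : q ∈ c.targets := by
  unfold NFACode.targets
  induction w using List.reverseRecOn with
  | nil => exact List.mem_append.2 (.inl h)
  | append_singleton w a _ =>
    rw [NFA.evalFrom_append, NFA.evalFrom_singleton, NFA.mem_stepSet] at h
    obtain ⟨t, -, ht⟩ := h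
    exact List.mem_append.2 (.inr (List.mem_map.2 ⟨_, ht, rfl⟩))

lemma mem_allTargets {cs : List (NFACode A)} {c : NFACode A} (hc : c ∈ cs) {w : List A} {q : ℕ}
    (h : q ∈ c.nfa.evalFrom c.nfa.start w) : (c, q) ∈ allTargets cs :=
  List.mem_flatMap.2 ⟨c, hc, List.mem_map.2 ⟨q, NFACode.mem_targets h, rfl⟩⟩

/-- The states of a deterministic device running all automata in `cs` together with `η`. -/
abbrev JointState (N : Type v) (cs : List (NFACode A)) : Type max u v :=
  N × Set {x : NFACode A × ℕ // x ∈ allTargets cs}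

/-- The transition of the joint device. -/
def jointStep (η : FreeMonoid A →* N) (cs : List (NFACode A)) (s : JointState N cs) (a : A) :
    JointState N cs :=
  (s.1 * wordVal η [a],
    {q' | ∃ q ∈ s.2, q.1.1 = q'.1.1 ∧ (q.1.2, a, q'.1.2) ∈ q'.1.1.2.1})

/-- The transition morphism of the joint device. -/
def jointMorphism (η : FreeMonoid A →* N) (cs : List (NFACode A)) :
    FreeMonoid A →* (Function.End (JointState N cs))ᵐᵒᵖ :=
  FreeMonoid.lift fun a => MulOpposite.op fun s => jointStep η cs s a

variable {η : FreeMonoid A →* N} {cs : List (NFACode A)}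

/-- The opposite monoid makes products of letters act in reading order. -/
lemma wordVal_jointMorphism (w : List A) (s : JointState N cs) :
    (wordVal (jointMorphism η cs) w).unop s = w.foldl (jointStep η cs) s := by
  induction w generalizing s with
  | nil => rw [wordVal_nil]; rfl
  | cons a w ih =>
    rw [wordVal_cons, MulOpposite.unop_mul, List.foldl_cons, ← ih]
    rfl

lemma foldl_jointStep (w : List A) :
    w.foldl (jointStep η cs) (1, {q | q.1.2 ∈ q.1.1.1}) =
      (wordVal η w, {q | q.1.2 ∈ q.1.1.nfa.evalFrom q.1.1.nfa.start w}) := by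
  induction w using List.reverseRecOn with
  | nil => simp; rfl
  | append_singleton w a ih =>
    rw [List.foldl_append, ih, List.foldl_cons, List.foldl_nil, jointStep, wordVal_append]
    refine Prod.ext rfl (Set.ext fun q' => ?_)
    obtain ⟨⟨c, q'⟩, hq'⟩ := q'
    obtain ⟨c', hc', hmap⟩ := List.mem_flatMap.1 hq'
    obtain ⟨_, _, hpair⟩ := List.mem_map.1 hmap
    obtain rfl : c' = c := congrArg Prod.fst hpair
    change _ ↔ q' ∈ c'.nfa.evalFrom c'.nfa.start (w ++ [a])
    rw [NFA.evalFrom_append, NFA.evalFrom_singleton, NFA.mem_stepSet]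
    constructor
    · rintro ⟨⟨⟨c, q⟩, hq⟩, hqw, h, htr⟩
      obtain rfl : c = c' := h
      exact ⟨q, hqw, htr⟩
    · rintro ⟨q, hq, htr⟩
      exact ⟨⟨(c', q), mem_allTargets hc' hq⟩, hq, rfl, htr⟩

/-- Running the device from its initial state records the `η`-value and the reachable states of each
automaton. Hence its morphism refines `η` and recognizes all inputs, as the covering criterion
demands. -/
lemma wordVal_eq_of_jointMorphism {u v : List A}
    (h : wordVal (jointMorphism η cs) u = wordVal (jointMorphism η cs) v) :
    wordVal η u = wordVal η v ∧ ∀ c ∈ cs, u ∈ c.language → v ∈ c.language := by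
  have h' := congrArg (fun f => f.unop (1, {q | q.1.2 ∈ q.1.1.1})) h
  simp only [wordVal_jointMorphism, foldl_jointStep] at h'
  refine ⟨congrArg Prod.fst h', fun c hc hu => ?_⟩
  obtain ⟨q, hacc, hq⟩ := hu
  exact ⟨q, hacc, (Set.ext_iff.1 (congrArg Prod.snd h') ⟨(c, q), mem_allTargets hc hq⟩).1 hq⟩

lemma card_subtype_mem_le {α : Type*} (l : List α) : Nat.card {x // x ∈ l} ≤ l.length := by
  classical
  rw [Nat.card_congr (Equiv.subtypeEquivRight fun x => (List.mem_toFinset (l := l)).symm),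
    Nat.card_eq_fintype_card, Fintype.card_coe]
  exact List.toFinset_card_le l

lemma finite_subtype_mem {α : Type*} (l : List α) : Finite {x // x ∈ l} :=
  List.finite_toSet l

lemma finite_jointState {N : Type v} [Finite N] (cs : List (NFACode A)) :
    Finite (JointState N cs) := by
  have := finite_subtype_mem (allTargets cs)
  infer_instance

lemma finite_end {X : Type*} [Finite X] : Finite (Function.End X)ᵐᵒᵖ := by
  have : Finite (Function.End X) := inferInstanceAs (Finite (X → X))
  exact Finite.of_equiv _ MulOpposite.opEquiv

lemma card_jointMorphism_le [Finite N] (cs : List (NFACode A)) {n : ℕ}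
    (hn : Nat.card N * 2 ^ (allTargets cs).length ≤ n) :
    Nat.card (Function.End (JointState N cs))ᵐᵒᵖ ≤ n ^ n := by
  have := finite_subtype_mem (allTargets cs)
  have := finite_jointState (N := N) cs
  have hX : Nat.card (JointState N cs) ≤ n := by
    refine le_trans ?_ hn
    have := Fintype.ofFinite {x // x ∈ allTargets cs}
    have hset : Nat.card (Set {x // x ∈ allTargets cs}) =
        2 ^ Nat.card {x // x ∈ allTargets cs} := by simp
    rw [Nat.card_prod, hset]
    gcongr
    · norm_num
    · exact card_subtype_mem_le _
  rw [Nat.card_congr MulOpposite.opEquiv.symm,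
    show Nat.card (Function.End (JointState N cs)) =
      Nat.card (JointState N cs → JointState N cs) from rfl, Nat.card_fun]
  have hpos : 0 < Nat.card (JointState N cs) := Nat.card_pos
  exact (Nat.pow_le_pow_left hX _).trans (Nat.pow_le_pow_right (by omega) hX)

end Automata

/-! ### Primitive recursive bounded search -/

section PrimitiveRecursion

variable {β : Type*} {γ : Type*} [Primcodable β] [Primcodable γ]

lemma primrecPred_forall_mem {f : β → List γ} {P : β → γ → Prop} (hf : Primrec f)
    (hP : PrimrecRel P) : PrimrecPred fun b => ∀ c ∈ f b, P b c :=
  (PrimrecRel.forall_mem_list (R := fun c b => P b c)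
    (hP.comp Primrec.snd Primrec.fst)).comp hf Primrec.id

lemma primrecPred_exists_mem {f : β → List γ} {P : β → γ → Prop} (hf : Primrec f)
    (hP : PrimrecRel P) : PrimrecPred fun b => ∃ c ∈ f b, P b c :=
  (PrimrecRel.exists_mem_list (R := fun c b => P b c)
    (hP.comp Primrec.snd Primrec.fst)).comp hf Primrec.id

lemma primrecPred_imp {P Q : β → Prop} (hP : PrimrecPred P) (hQ : PrimrecPred Q) :
    PrimrecPred fun b => P b → Q b :=
  (hP.not.or hQ).of_eq fun _ => imp_iff_not_or.symm

lemma primrecPred_mem {f : β → γ} {g : β → List γ} (hf : Primrec f) (hg : Primrec g) :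
    PrimrecPred fun b => f b ∈ g b :=
  (primrecPred_exists_mem (P := fun b c => c = f b) hg
    (Primrec.eq.comp Primrec.snd (hf.comp Primrec.fst))).of_eq fun b => by simp

lemma primrec_pow {f g : β → ℕ} (hf : Primrec f) (hg : Primrec g) :
    Primrec fun b => f b ^ g b :=
  (Primrec₂.unpaired'.1 Nat.Primrec.pow).comp hf hg

end PrimitiveRecursion

/-! ### Enumeration of short words -/

section Words

variable {A : Type u}

/-- The words of length at most `n` over the letters in `as`. -/
def wordsUpTo (as : List A) : ℕ → List (List A)
  | 0 => [[]]
  | n + 1 => [] :: (wordsUpTo as n).flatMap fun w => as.map fun a => a :: w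

lemma mem_wordsUpTo {as : List A} (has : ∀ a, a ∈ as) {n : ℕ} {w : List A} :
    w ∈ wordsUpTo as n ↔ w.length ≤ n := by
  induction n generalizing w with
  | zero => simp [wordsUpTo]
  | succ n ih => cases w <;> simp [wordsUpTo, ih, has]

lemma primrec_wordsUpTo [Primcodable A] (as : List A) : Primrec (wordsUpTo as) := by
  have hstep : Primrec₂ fun (_ : ℕ) (ws : List (List A)) =>
      ([] : List A) :: ws.flatMap fun w => as.map fun a => a :: w := by
    refine Primrec.list_cons.comp (Primrec.const []) (Primrec.list_flatMap Primrec.snd ?_)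
    exact Primrec.list_map (Primrec.const as)
      (Primrec.list_cons.comp Primrec.snd (Primrec.snd.comp Primrec.fst))
  refine (Primrec.nat_rec₁ [[]] hstep).of_eq fun n => ?_
  induction n with
  | zero => rfl
  | succ n ih => simp only [wordsUpTo, ← ih]

end Words

/-! ### Computing the monomials of a word -/

section Monomials

variable {A : Type u} {N : Type v} [Monoid N]

/-- The monomials containing a word. -/
def monoList (η : FreeMonoid A →* N) (w : List A) : List (N × List (A × N)) :=
  w.foldr (fun a ms => ms.flatMap fun m => [(wordVal η [a] * m.1, m.2), (1, (a, m.1) :: m.2)])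
    [(1, [])]

lemma mem_monoList {η : FreeMonoid A →* N} {w : List A} {x : N} {l : List (A × N)} :
    (x, l) ∈ monoList η w ↔ Mono η w x l := by
  induction w generalizing x l with
  | nil =>
    constructor
    · intro h
      obtain ⟨rfl, rfl⟩ : x = 1 ∧ l = [] := by simpa [monoList] using h
      exact .nil
    · rintro ⟨⟩
      simp [monoList]
  | cons a w ih =>
    change (x, l) ∈ (monoList η w).flatMap _ ↔ _
    rw [List.mem_flatMap]
    constructor
    · rintro ⟨⟨y, l'⟩, hm, h⟩
      simp only [List.mem_cons, Prod.mk.injEq, List.not_mem_nil, or_false] at h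
      rcases h with ⟨rfl, rfl⟩ | ⟨rfl, rfl⟩
      · exact .skip _ _ _ _ (ih.1 hm)
      · exact .mark _ _ _ _ (ih.1 hm)
    · rintro (_ | ⟨_, _, y, _, h⟩ | ⟨_, _, y, l', h⟩)
      · exact ⟨_, ih.2 h, by simp⟩
      · exact ⟨_, ih.2 h, by simp⟩

lemma monoLE_iff_monoList {η : FreeMonoid A →* N} {k : ℕ} {w v : List A} :
    MonoLE η k w v ↔ ∀ m ∈ monoList η w, m.2.length ≤ k → m ∈ monoList η v :=
  ⟨fun h _ hm hl => mem_monoList.2 (h _ _ hl (mem_monoList.1 hm)),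
    fun h _ _ hl hw => mem_monoList.1 (h _ (mem_monoList.2 hw) hl)⟩

lemma primrec_monoList [Finite A] [Finite N] [Primcodable A] [Primcodable N]
    (η : FreeMonoid A →* N) : Primrec (monoList η) := by
  have ha : Primrec fun p : (List A × A × List (N × List (A × N))) × N × List (A × N) => p.1.2.1 :=
    Primrec.fst.comp (Primrec.snd.comp Primrec.fst)
  have hx : Primrec fun p : (List A × A × List (N × List (A × N))) × N × List (A × N) => p.2.1 :=
    Primrec.fst.comp Primrec.snd
  have hl : Primrec fun p : (List A × A × List (N × List (A × N))) × N × List (A × N) => p.2.2 :=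
    Primrec.snd.comp Primrec.snd
  -- A function on a finite type is a table, so nothing has to be computed from `η`.
  have hmul : Primrec₂ fun (a : A) (x : N) => wordVal η [a] * x :=
    Primrec.dom_finite (fun p : A × N => wordVal η [p.1] * p.2)
  have hext : Primrec₂ fun (p : List A × A × List (N × List (A × N))) (m : N × List (A × N)) =>
      [(wordVal η [p.2.1] * m.1, m.2), (1, (p.2.1, m.1) :: m.2)] :=
    Primrec.list_cons.comp ((hmul.comp ha hx).pair hl) (Primrec.list_cons.comp
      ((Primrec.const 1).pair (Primrec.list_cons.comp (ha.pair hx) hl)) (Primrec.const []))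
  have hstep : Primrec₂ fun (_ : List A) (p : A × List (N × List (A × N))) =>
      p.2.flatMap fun m => [(wordVal η [p.1] * m.1, m.2), (1, (p.1, m.1) :: m.2)] :=
    Primrec.list_flatMap (Primrec.snd.comp Primrec.snd) hext
  exact Primrec.list_foldr Primrec.id (Primrec.const _) hstep

lemma primrecPred_monoLE [Finite A] [Finite N] [Primcodable A] [Primcodable N]
    (η : FreeMonoid A →* N) {β : Type*} [Primcodable β] {k : β → ℕ} {w v : β → List A}
    (hk : Primrec k) (hw : Primrec w) (hv : Primrec v) :
    PrimrecPred fun b => MonoLE η (k b) (w b) (v b) := by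
  refine (primrecPred_forall_mem ((primrec_monoList η).comp hw) (P := fun b m =>
    m.2.length ≤ k b → m ∈ monoList η (v b)) ?_).of_eq fun b => monoLE_iff_monoList.symm
  exact primrecPred_imp
    (Primrec.nat_le.comp (Primrec.list_length.comp (Primrec.snd.comp Primrec.snd))
      (hk.comp Primrec.fst))
    (primrecPred_mem Primrec.snd ((primrec_monoList η).comp (hv.comp Primrec.fst)))

end Monomials

/-! ### Simulating automata -/

section Automata

variable {A : Type u}

/-- One step of the simulation of an automaton on lists of states. -/
def NFACode.stepList [DecidableEq A] (c : NFACode A) (S : List ℕ) (a : A) : List ℕ :=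
  c.2.1.flatMap fun t => if t.1 ∈ S ∧ t.2.1 = a then [t.2.2] else []

lemma NFACode.mem_stepList [DecidableEq A] {c : NFACode A} {S : List ℕ} {a : A} {q' : ℕ} :
    q' ∈ c.stepList S a ↔ ∃ q ∈ S, (q, a, q') ∈ c.2.1 := by
  rw [NFACode.stepList, List.mem_flatMap]
  constructor
  · rintro ⟨⟨q, b, q''⟩, ht, h⟩
    split_ifs at h with hc
    · obtain rfl : q' = q'' := by simpa using h
      obtain rfl : b = a := hc.2
      exact ⟨q, hc.1, ht⟩
    · simp at h
  · rintro ⟨q, hq, ht⟩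
    exact ⟨_, ht, by simp [hq]⟩

lemma NFACode.mem_foldl_stepList [DecidableEq A] {c : NFACode A} {w : List A} {q : ℕ} :
    q ∈ w.foldl c.stepList c.1 ↔ q ∈ c.nfa.evalFrom c.nfa.start w := by
  induction w using List.reverseRecOn generalizing q with
  | nil => rfl
  | append_singleton w a ih =>
    rw [List.foldl_append, List.foldl_cons, List.foldl_nil, NFACode.mem_stepList,
      NFA.evalFrom_append, NFA.evalFrom_singleton, NFA.mem_stepSet]
    exact exists_congr fun q' => and_congr ih Iff.rfl

lemma primrecPred_mem_language [Primcodable A] {β : Type*} [Primcodable β] {w : β → List A}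
    {c : β → NFACode A} (hw : Primrec w) (hc : Primrec c) :
    PrimrecPred fun b => w b ∈ (c b).language := by
  classical
  have hstep : Primrec₂ fun (b : β) (p : List ℕ × A) => (c b).stepList p.1 p.2 := by
    refine Primrec.list_flatMap (Primrec.fst.comp (Primrec.snd.comp (hc.comp Primrec.fst)))
      (Primrec.ite (PrimrecPred.and ?_ ?_) ?_ (Primrec.const []))
    · exact primrecPred_mem (Primrec.fst.comp Primrec.snd)
        (Primrec.fst.comp (Primrec.snd.comp Primrec.fst))
    · exact Primrec.eq.comp (Primrec.fst.comp (Primrec.snd.comp Primrec.snd))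
        (Primrec.snd.comp (Primrec.snd.comp Primrec.fst))
    · exact Primrec.list_cons.comp (Primrec.snd.comp (Primrec.snd.comp Primrec.snd))
        (Primrec.const [])
  have hfold : Primrec fun b => (w b).foldl (c b).stepList (c b).1 :=
    Primrec.list_foldl hw (Primrec.fst.comp hc) hstep
  refine (primrecPred_exists_mem (P := fun b q => q ∈ (c b).2.2) hfold
    (primrecPred_mem Primrec.snd
      (Primrec.snd.comp (Primrec.snd.comp (hc.comp Primrec.fst))))).of_eq fun b => ?_
  simp only [NFACode.mem_foldl_stepList]
  exact exists_congr fun q => and_comm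

lemma primrec_allTargets [Primcodable A] : Primrec (allTargets (A := A)) := by
  refine Primrec.list_flatMap Primrec.id (Primrec.list_map ?_ ?_)
  · refine Primrec.list_append.comp (Primrec.fst.comp Primrec.snd) (Primrec.list_map
      (Primrec.fst.comp (Primrec.snd.comp Primrec.snd)) ?_)
    exact Primrec.snd.comp (Primrec.snd.comp Primrec.snd)
  · exact (Primrec.snd.comp Primrec.fst).pair Primrec.snd

end Automata

/-! ### The decision procedure -/

section Decidability

variable {A : Type u} [Finite A]

/-- Since `C` is fixed, `N` and `η` are finite data built into the algorithm. Only the bounds and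
the search over short words depend on the input, and both are primitive recursive. -/
theorem coveringDecidable_pol [Primcodable A] {N : Type v} [Monoid N] [Finite N]
    {C : BooleanSubalgebra (Language A)} (hfin : (C : Set (Language A)).Finite)
    {η : FreeMonoid A →* N} (hη : IsClassMorphism (C : Set (Language A)) η) :
    CoveringDecidable (Pol (C : Set (Language A))) := by
  obtain ⟨n, ⟨eN⟩⟩ := Finite.exists_equiv_fin N
  let _ : Primcodable N := Primcodable.ofEquiv (Fin n) eN
  obtain ⟨as, -, has⟩ := Finite.exists_univ_list A
  -- Upper bounds for, in turn, the states of the joint device, its transition monoid, the marks to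
  -- inspect and the length of words to search. Overestimates are harmless, as the criterion holds
  -- for all larger bounds.
  let size : NFACode A × List (NFACode A) → ℕ := fun p =>
    Nat.card N * 2 ^ (allTargets (p.1 :: p.2)).length
  let card : NFACode A × List (NFACode A) → ℕ := fun p => size p ^ size p
  let marks : NFACode A × List (NFACode A) → ℕ := fun p => 9 * 4 ^ (card p * 2 ^ card p)
  let len : NFACode A × List (NFACode A) → ℕ := fun p =>
    card p * 2 ^ (Nat.card N * (Nat.card A * Nat.card N + 1) ^ marks p)
  have hsize : Primrec size := Primrec.nat_mul.comp (Primrec.const _) (primrec_pow (Primrec.const 2)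
    (Primrec.list_length.comp (primrec_allTargets.comp
      (Primrec.list_cons.comp Primrec.fst Primrec.snd))))
  have hcard : Primrec card := primrec_pow hsize hsize
  have hmarks : Primrec marks := Primrec.nat_mul.comp (Primrec.const 9) (primrec_pow
    (Primrec.const 4) (Primrec.nat_mul.comp hcard (primrec_pow (Primrec.const 2) hcard)))
  have hlen : Primrec len := Primrec.nat_mul.comp hcard (primrec_pow (Primrec.const 2)
    (Primrec.nat_mul.comp (Primrec.const _) (primrec_pow (Primrec.const _) hmarks)))
  have hprim : PrimrecPred fun p : NFACode A × List (NFACode A) =>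
      ∀ w ∈ wordsUpTo as (len p), w ∈ p.1.language →
        ∃ c ∈ p.2, ∀ v ∈ wordsUpTo as (len p), v ∈ c.language → ¬ MonoLE η (marks p) w v := by
    refine primrecPred_forall_mem ((primrec_wordsUpTo as).comp hlen) (primrecPred_imp
      (primrecPred_mem_language Primrec.snd (Primrec.fst.comp Primrec.fst))
      (primrecPred_exists_mem (Primrec.snd.comp Primrec.fst) (primrecPred_forall_mem
        ((primrec_wordsUpTo as).comp (hlen.comp (Primrec.fst.comp Primrec.fst))) (primrecPred_imp
          (primrecPred_mem_language Primrec.snd (Primrec.snd.comp Primrec.fst))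
          (PrimrecPred.not (primrecPred_monoLE η ?_ ?_ Primrec.snd))))))
    · exact hmarks.comp (Primrec.fst.comp (Primrec.fst.comp Primrec.fst))
    · exact Primrec.snd.comp (Primrec.fst.comp Primrec.fst)
  refine (hprim.of_eq fun p => ?_).computablePred
  have := finite_jointState (N := N) (p.1 :: p.2)
  have := finite_end (X := JointState N (p.1 :: p.2))
  have hle : Nat.card (Function.End (JointState N (p.1 :: p.2)))ᵐᵒᵖ ≤ card p :=
    card_jointMorphism_le (p.1 :: p.2) le_rfl
  have hrec : ∀ c ∈ p.1 :: p.2, ∀ u v, wordVal (jointMorphism η (p.1 :: p.2)) u =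
      wordVal (jointMorphism η (p.1 :: p.2)) v → u ∈ c.language → v ∈ c.language :=
    fun c hc u v h => (wordVal_eq_of_jointMorphism h).2 c hc
  rw [isCoverable_pol_iff_bounded (α := jointMorphism η (p.1 :: p.2)) (k := marks p) (B := len p)
    hfin hη (fun u v h => (wordVal_eq_of_jointMorphism h).1) (hrec p.1 (by simp)) ?_ ?_ ?_]
  · simp only [mem_wordsUpTo has]
    refine forall_congr' fun w => imp_congr_right fun _ => imp_congr_right fun _ => ?_
    constructor
    · rintro ⟨c, hc, h⟩
      exact ⟨_, ⟨c, hc, rfl⟩, h⟩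
    · rintro ⟨_, ⟨c, hc, rfl⟩, h⟩
      exact ⟨c, hc, h⟩
  · rintro _ ⟨c, hc, rfl⟩
    exact hrec c (by simp [hc])
  · change _ ≤ 9 * 4 ^ (card p * 2 ^ card p)
    gcongr <;> norm_num
  · change _ ≤ card p * _
    gcongr

end Decidability

end Covering

theorem mainTheorem3 {A : Type*} [Finite A] (C : BooleanSubalgebra (Language A))
    (hfin : (C : Set (Language A)).Finite)
    (hquot : Covering.IsQuotienting (C : Set (Language A))) :
    (∀ {M : Type*} [Monoid M] [Finite M] (α : FreeMonoid A →* M) (cls : M → Language A),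
      Covering.IsClassMap (C : Set (Language A)) α cls →
      ∀ {R : Type*} [NonUnitalSemiring R] [Finite R], (∀ r : R, r + r = r) →
      ∀ ρ : Language A →ₙ+* R,
        IsLeast {S : Set (M × R) | Covering.IsPolSaturated α cls ρ S}
          (Covering.pointedOptImprint (Covering.Pol (C : Set (Language A))) α ρ)) ∧
    (∀ [Primcodable A],
      Covering.CoveringDecidable (Covering.Pol (C : Set (Language A)))) := by
  have := Covering.finite_simCon_quotient (C : Set (Language A)) hquot hfin
  have hη := Covering.isClassMorphism_simCon (C : Set (Language A)) hquot
  exact ⟨fun _ _ hcls _ _ _ hR _ => Covering.isLeast_pointedOptImprint hfin hη hcls hR,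
    Covering.coveringDecidable_pol hfin hη⟩
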